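/- Let $$P(q)=1-24\sum_{n\ge1}\frac{nq^n}{1-q^n},\qquad Q(q)=1+240\sum_{n\ge1}\frac{n^3q^n}{1-q^n},\qquad R(q)=1-504\sum_{n\ge1}\frac{n^5q^n}{1-q^n}\qquad(|q|<1).$$ The hypergeometric series ${}_2F_1(\tfrac16,\tfrac12;1;s)$ and ${}_2F_1(\tfrac16,\tfrac12;\tfrac23;s)$ continue analytically from the unit disc to $\mathbb C\setminus[1,\infty)$; call the continuations $\chi_1$ and $\varphi$. For $s\in\Omega:=\mathbb C\setminus\big((-\infty,0]\cup[1,\infty)\big)$ put $$z(s)=\frac{\chi_2(s)}{\chi_1(s)},\qquad \chi_2(s)=A\,\varphi(1-s)+B\,\chi_1(s),\qquad A=\frac{i}{\pi}\,\frac{\Gamma(1/6)\Gamma(1/2)}{\Gamma(2/3)},\qquad B=-e^{\pi i/3}.$$ This quotient is normalized as follows: there is a function $h$ holomorphic at $0$ such that $z(s)=\frac{i}{\pi}(-\log s+h(s))+B$ for all $s\in\Omega$ near $0$ (principal logarithm), and $z(s)\to e^{2\pi i/3}$ as $s\to1$, $s\in(0,1)$. Moreover $z$ is inverted by an automorphic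 function (the triangle function $S(0,\tfrac13,\tfrac13;z)$): there is a meromorphic function $S$ on the upper half-plane, invariant under the group $\Gamma^2\subset\mathrm{SL}_2(\mathbb Z)$ generated by $\begin{pmatrix}0&-1\\1&1\end{pmatrix}$ and $\begin{pmatrix}1&-1\\1&0\end{pmatrix}$ (acting as $z\mapsto-1/(z+1)$ and $z\mapsto(z-1)/z$), which is normal of index $2$ in $\mathrm{SL}_2(\mathbb Z)$, with $S(z(s))=s$ for all $s\in\Omega$. For every $s\in\Omega$ one has $\chi_1(s)\neq0$ and $\operatorname{Im}z(s)>0$, and with $q=e^{2\pi i z(s)}$, $$P(q)=(1-s)^{2/3}\big(\chi_1(s)^2+6s\,\chi_1(s)\chi_1'(s)\big),\qquad Q(q)=(1-s)^{1/3}\chi_1(s)^4,\qquad R(q)=\big(1-\tfrac s2\big)\chi_1(s)^6,$$ where the powers of $1-s$ are the principal ones. -/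

import Mathlib

open Filter Topology

noncomputable section

/-- Ramanujan's `P(q) = 1 - 24 ∑_{n ≥ 1} n qⁿ / (1 - qⁿ)`, for `|q| < 1`. -/
def ramanujanP (q : ℂ) : ℂ :=
  1 - 24 * ∑' n : ℕ+, (n : ℂ) * q ^ (n : ℕ) / (1 - q ^ (n : ℕ))

/-- Ramanujan's `Q(q) = 1 + 240 ∑_{n ≥ 1} n³ qⁿ / (1 - qⁿ)`, for `|q| < 1`. -/
def ramanujanQ (q : ℂ) : ℂ :=
  1 + 240 * ∑' n : ℕ+, (n : ℂ) ^ 3 * q ^ (n : ℕ) / (1 - q ^ (n : ℕ))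

/-- Ramanujan's `R(q) = 1 - 504 ∑_{n ≥ 1} n⁵ qⁿ / (1 - qⁿ)`, for `|q| < 1`. -/
def ramanujanR (q : ℂ) : ℂ :=
  1 - 504 * ∑' n : ℕ+, (n : ℂ) ^ 5 * q ^ (n : ℕ) / (1 - q ^ (n : ℕ))

/-- `F` is the principal branch of the hypergeometric function `₂F₁(a, b; c; ·)`: the analytic
continuation of the hypergeometric series from the unit disc to `ℂ ∖ [1, ∞)`
(which is the set of `s` with `1 - s` in Mathlib's slit plane `ℂ ∖ (-∞, 0]`). -/
structure IsHypergeometricBranch (a b c : ℂ) (F : ℂ → ℂ) : Prop where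
  analytic : AnalyticOnNhd ℂ F {s : ℂ | 1 - s ∈ Complex.slitPlane}
  eq_series : ∀ s : ℂ, ‖s‖ < 1 → F s = ordinaryHypergeometric a b c s

/-- The doubly cut plane `ℂ ∖ ((-∞, 0] ∪ [1, ∞))`. -/
def cutPlane : Set ℂ :=
  {s : ℂ | s ∈ Complex.slitPlane ∧ 1 - s ∈ Complex.slitPlane}

/-- The constant `A`, chosen so that `A Γ(2/3) / (Γ(1/6) Γ(1/2)) = i / π`. -/
def constA : ℂ :=
  Complex.I / Real.pi * (Complex.Gamma (1 / 6) * Complex.Gamma (1 / 2) / Complex.Gamma (2 / 3))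

/-- The constant `B = -e^{πi/3}`. -/
def constB : ℂ := -Complex.exp (Real.pi * Complex.I / 3)

/-- The quotient `z(s) = χ₂(s) / χ₁(s)` with `χ₂(s) = A φ(1 - s) + B χ₁(s)`. -/
def zQuot (χ₁ φ : ℂ → ℂ) (s : ℂ) : ℂ :=
  (constA * φ (1 - s) + constB * χ₁ s) / χ₁ s

/-- The group `Γ²`, generated by `z ↦ -1 / (z + 1)` and `z ↦ (z - 1) / z`
(it contains `-1`, the cube of the first generator). -/
def GammaSq : Subgroup (Matrix.SpecialLinearGroup (Fin 2) ℤ) :=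
  Subgroup.closure
    {⟨!![0, -1; 1, 1], by simp [Matrix.det_fin_two_of]⟩,
     ⟨!![1, -1; 1, 0], by simp [Matrix.det_fin_two_of]⟩}

end

/-! The triple (P, Q, R)(q(s)) and the triple of right-hand sides solve the same first-order system
in s, with a regular singular point at s = 0; a uniqueness statement there and analytic continuation
identify them. On the modular side the system is Ramanujan's (`mul_deriv_ramanujanP`,
`mul_deriv_ramanujanQ`, `mul_deriv_ramanujanR`), pulled back along q = e^{2πiz}. The change of
variable is explicit: χ₁ and φ(1 - ·) solve the same hypergeometric equation, so their weighted
Wronskian is constant and z' = -(i/π) / (s (1-s)^{2/3} χ₁²) (`hasDerivAt_zQuot`). On the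
hypergeometric side the system is `mul_deriv_param`.

The delicate point is the additive constant of z at s = 0, that is, the leading coefficient of q.
The system is resonant at order 2: it does not see a rescaling of q. Comparing Q³ - R² = 1728 q
∏(1-qⁿ)²⁴ with -s²χ₁¹²/4 shows that the coefficient must be -1/6912. No connection formula at 0 is
used to find it. Instead z is replaced by z + iδ, with δ chosen to produce this coefficient; δ is
real because Re z = -1/2 on (0,1). This gives the identities near 0
(`eventually_ramanujan_eq_param`). They spread over the cut plane together with Im(z + iδ) > 0,
because y⁶(|Q|³ + |R|²) is bounded below on the upper half-plane while the hypergeometric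
expressions stay finite (`isParam_of_mem_cutPlane`). Finally δ = 0 is read off at s → 1, where z
tends to ω = e^{2πi/3} by Gauss's summation and Q tends to 0 (`eq_zero_of_isParam`).

For the inverse function, R/η¹² changes sign under both S and T, hence is Γ²-invariant; η¹² is a
constant times s χ₁⁶, so R/η¹² is a Möbius function of s. Non-vanishing of χ₁ comes from Euler's
integral, whose real part is positive. -/

/-! ### The group Γ²: normality and index. -/

open ModularGroup MatrixGroups in
theorem GammaSq_eq_closure : GammaSq = Subgroup.closure {S * T, T * S} := by
  have h1 : S * T = ⟨!![0, -1; 1, 1], by simp [Matrix.det_fin_two_of]⟩ := by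
    ext i j
    fin_cases i <;> fin_cases j <;> rfl
  have h2 : T * S = ⟨!![1, -1; 1, 0], by simp [Matrix.det_fin_two_of]⟩ := by
    ext i j
    fin_cases i <;> fin_cases j <;> rfl
  rw [h1, h2]
  rfl

open ModularGroup MatrixGroups in
theorem ST_mem_GammaSq : S * T ∈ GammaSq := by
  rw [GammaSq_eq_closure]
  exact Subgroup.subset_closure (by simp)

open ModularGroup MatrixGroups in
theorem TS_mem_GammaSq : T * S ∈ GammaSq := by
  rw [GammaSq_eq_closure]
  exact Subgroup.subset_closure (by simp)

open ModularGroup MatrixGroups in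
theorem S_sq_mem_GammaSq : S * S ∈ GammaSq := by
  have : S * S = (S * T) * (S * T) * (S * T) := by
    ext i j
    fin_cases i <;> fin_cases j <;> rfl
  rw [this]
  exact mul_mem (mul_mem ST_mem_GammaSq ST_mem_GammaSq) ST_mem_GammaSq

-- Conjugation by S sends ST to TS, and TS to a conjugate of ST by S², which lies in the group.
open ModularGroup MatrixGroups in
theorem S_inv_mul_mul_S_mem_GammaSq {g : SL(2, ℤ)} (hg : g ∈ GammaSq) : S⁻¹ * g * S ∈ GammaSq := by
  rw [GammaSq_eq_closure] at hg
  induction hg using Subgroup.closure_induction with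
  | one => simp
  | mem g hg =>
    rcases hg with rfl | rfl
    · simpa [mul_assoc] using TS_mem_GammaSq
    · have : S⁻¹ * (T * S) * S = (S * S)⁻¹ * (S * T) * (S * S) := by group
      rw [this]
      exact mul_mem (mul_mem (inv_mem S_sq_mem_GammaSq) ST_mem_GammaSq) S_sq_mem_GammaSq
  | mul g h _ _ ig ih =>
    have : S⁻¹ * (g * h) * S = (S⁻¹ * g * S) * (S⁻¹ * h * S) := by group
    rw [this]
    exact mul_mem ig ih
  | inv g _ ig =>
    have : S⁻¹ * g⁻¹ * S = (S⁻¹ * g * S)⁻¹ := by group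
    rw [this]
    exact inv_mem ig

-- S and T both lie in the coset S Γ², and S normalizes Γ², so at most two cosets occur.
open ModularGroup MatrixGroups in
theorem mem_GammaSq_or_S_inv_mul_mem (g : SL(2, ℤ)) : g ∈ GammaSq ∨ S⁻¹ * g ∈ GammaSq := by
  have : g ∈ Subgroup.closure {S, T} := by simp [SpecialLinearGroup.SL2Z_generators]
  have hS2 := S_sq_mem_GammaSq
  induction this using Subgroup.closure_induction with
  | one => exact Or.inl GammaSq.one_mem
  | mem g hg =>
    rcases hg with rfl | rfl
    · right
      simp
    · right
      have : S⁻¹ * T = (S * S)⁻¹ * (S * T) := by group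
      rw [this]
      exact mul_mem (inv_mem hS2) ST_mem_GammaSq
  | mul g h _ _ ig ih =>
    rcases ig with ig | ig <;> rcases ih with ih | ih
    · exact Or.inl (mul_mem ig ih)
    · right
      have : S⁻¹ * (g * h) = (S⁻¹ * g * S) * (S⁻¹ * h) := by group
      rw [this]
      exact mul_mem (S_inv_mul_mul_S_mem_GammaSq ig) ih
    · right
      rw [← mul_assoc]
      exact mul_mem ig ih
    · left
      have : g * h = (S * S) * (S⁻¹ * (S⁻¹ * g) * S) * (S⁻¹ * h) := by group
      rw [this]
      exact mul_mem (mul_mem hS2 (S_inv_mul_mul_S_mem_GammaSq ig)) ih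
  | inv g _ ig =>
    rcases ig with ig | ig
    · exact Or.inl (inv_mem ig)
    · right
      have : S⁻¹ * g⁻¹ = (S⁻¹ * (S⁻¹ * g) * S)⁻¹ * (S * S)⁻¹ := by group
      rw [this]
      exact mul_mem (inv_mem (S_inv_mul_mul_S_mem_GammaSq ig)) (inv_mem hS2)

-- SL₂(𝔽₂) is the symmetric group S₃, and both generators reduce into its subgroup of order 3. The
-- reduction of S has order 2, so this keeps S out of Γ².
open ModularGroup MatrixGroups in
theorem GammaSq_apply_mod_two {g : SL(2, ℤ)} (hg : g ∈ GammaSq) :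
    g.map (Int.castRingHom (ZMod 2)) ∈
      Subgroup.zpowers ((S * T).map (Int.castRingHom (ZMod 2))) := by
  rw [GammaSq_eq_closure] at hg
  induction hg using Subgroup.closure_induction with
  | one => rw [map_one]; exact one_mem _
  | mem g hg =>
    rcases hg with rfl | rfl
    · exact Subgroup.mem_zpowers _
    · refine Subgroup.mem_zpowers_iff.2 ⟨2, ?_⟩
      rw [zpow_ofNat, sq]
      ext i j
      fin_cases i <;> fin_cases j <;> decide
  | mul g h _ _ ig ih => rw [map_mul _ g h]; exact mul_mem ig ih
  | inv g _ ig => rw [map_inv]; exact inv_mem ig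

open ModularGroup MatrixGroups in
theorem S_notMem_GammaSq : S ∉ GammaSq := by
  intro h
  have h1 := Subgroup.mem_zpowers_iff.1 (GammaSq_apply_mod_two h)
  obtain ⟨k, hk⟩ := h1
  have h3 : ((S * T).map (Int.castRingHom (ZMod 2))) ^ 3 = 1 := by
    rw [pow_succ, sq]
    ext i j
    fin_cases i <;> fin_cases j <;> decide
  have h2 : (S.map (Int.castRingHom (ZMod 2))) ^ 3 = 1 := by
    rw [← hk, ← zpow_natCast, ← zpow_mul, mul_comm, zpow_mul, zpow_natCast, h3, one_zpow]
  rw [pow_succ, sq] at h2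
  have := congrArg (fun g : Matrix.SpecialLinearGroup (Fin 2) (ZMod 2) => g.1 0 0) h2
  revert this
  decide

open ModularGroup MatrixGroups in
theorem GammaSq_index : GammaSq.index = 2 := by
  rw [Subgroup.index_eq_two_iff]
  refine ⟨S⁻¹, fun g => ?_⟩
  -- The index criterion multiplies on the right, while the coset dichotomy multiplies on the left.
  have key (g : SL(2, ℤ)) : g * S⁻¹ ∈ GammaSq ↔ S⁻¹ * g ∈ GammaSq := by
    have e1 : g * S⁻¹ = (S * S) * (S⁻¹ * (S⁻¹ * g) * S) * (S * S)⁻¹ := by group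
    have e2 : S⁻¹ * g = S⁻¹ * (g * S⁻¹) * S := by group
    constructor
    · intro h
      rw [e2]
      exact S_inv_mul_mul_S_mem_GammaSq h
    · intro h
      rw [e1]
      exact mul_mem (mul_mem S_sq_mem_GammaSq (S_inv_mul_mul_S_mem_GammaSq h))
        (inv_mem S_sq_mem_GammaSq)
  rw [key]
  rcases mem_GammaSq_or_S_inv_mul_mem g with h | h
  · refine Or.inr ⟨h, fun h' => S_notMem_GammaSq ?_⟩
    have : S = g * (S⁻¹ * g)⁻¹ := by group
    rw [this]
    exact mul_mem h (inv_mem h')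
  · refine Or.inl ⟨h, fun h' => S_notMem_GammaSq ?_⟩
    have : S = g * (S⁻¹ * g)⁻¹ := by group
    rw [this]
    exact mul_mem h' (inv_mem h)

theorem GammaSq_normal : GammaSq.Normal := Subgroup.normal_of_index_eq_two GammaSq_index

/-! ### Eisenstein series as power series in q. -/

section

open ArithmeticFunction in
theorem summable_sigma_mul_pow (k : ℕ) {r : ℝ} (h0 : 0 ≤ r) (h1 : r < 1) :
    Summable fun n : ℕ+ => (sigma k n : ℝ) * r ^ (n : ℕ) := by
  have h : Summable fun n : ℕ => (n : ℝ) ^ (k + 1) * r ^ n :=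
    summable_pow_mul_geometric_of_norm_lt_one _ (by rwa [Real.norm_of_nonneg h0])
  refine Summable.of_nonneg_of_le (fun n => by positivity) (fun n => ?_)
    (h.comp_injective PNat.coe_injective)
  simp only [Function.comp]
  gcongr
  exact_mod_cast sigma_le_pow_succ k n

open ArithmeticFunction in
theorem differentiableOn_tsum_sigma_mul_pow (k : ℕ) :
    DifferentiableOn ℂ (fun q : ℂ => ∑' n : ℕ+, (sigma k n : ℂ) * q ^ (n : ℕ))
      (Metric.ball 0 1) := by
  intro q hq
  rw [mem_ball_zero_iff] at hq
  obtain ⟨r, hr, hr1⟩ := exists_between hq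
  have h0 : 0 ≤ r := (norm_nonneg q).trans hr.le
  have := Complex.differentiableOn_tsum_of_summable_norm (summable_sigma_mul_pow k h0 hr1)
    (F := fun (n : ℕ+) (q : ℂ) => (sigma k n : ℂ) * q ^ (n : ℕ)) (U := Metric.ball 0 r)
    (fun n => by fun_prop) Metric.isOpen_ball (fun n w hw => by
      rw [mem_ball_zero_iff] at hw
      rw [norm_mul, norm_pow, Complex.norm_natCast]
      exact mul_le_mul_of_nonneg_left (pow_le_pow_left₀ (norm_nonneg w) hw.le _)
        (Nat.cast_nonneg _))
  exact (this.differentiableAt (Metric.isOpen_ball.mem_nhds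
    (mem_ball_zero_iff.2 hr))).differentiableWithinAt

open ArithmeticFunction in
theorem ramanujanP_eq {q : ℂ} (hq : ‖q‖ < 1) :
    ramanujanP q = 1 - 24 * ∑' n : ℕ+, (sigma 1 n : ℂ) * q ^ (n : ℕ) := by
  rw [ramanujanP, ← tsum_pow_div_one_sub_eq_tsum_sigma hq]
  simp

open ArithmeticFunction in
theorem ramanujanQ_eq {q : ℂ} (hq : ‖q‖ < 1) :
    ramanujanQ q = 1 + 240 * ∑' n : ℕ+, (sigma 3 n : ℂ) * q ^ (n : ℕ) := by
  rw [ramanujanQ, ← tsum_pow_div_one_sub_eq_tsum_sigma hq]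

open ArithmeticFunction in
theorem ramanujanR_eq {q : ℂ} (hq : ‖q‖ < 1) :
    ramanujanR q = 1 - 504 * ∑' n : ℕ+, (sigma 5 n : ℂ) * q ^ (n : ℕ) := by
  rw [ramanujanR, ← tsum_pow_div_one_sub_eq_tsum_sigma hq]

theorem differentiableOn_ramanujanP : DifferentiableOn ℂ ramanujanP (Metric.ball 0 1) :=
  (((differentiableOn_tsum_sigma_mul_pow 1).const_mul 24).const_sub 1).congr
    fun _ hq => ramanujanP_eq (mem_ball_zero_iff.1 hq)

theorem differentiableOn_ramanujanQ : DifferentiableOn ℂ ramanujanQ (Metric.ball 0 1) :=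
  (((differentiableOn_tsum_sigma_mul_pow 3).const_mul 240).const_add 1).congr
    fun _ hq => ramanujanQ_eq (mem_ball_zero_iff.1 hq)

theorem differentiableOn_ramanujanR : DifferentiableOn ℂ ramanujanR (Metric.ball 0 1) :=
  (((differentiableOn_tsum_sigma_mul_pow 5).const_mul 504).const_sub 1).congr
    fun _ hq => ramanujanR_eq (mem_ball_zero_iff.1 hq)

theorem ramanujanP_zero : ramanujanP 0 = 1 := by simp [ramanujanP]

theorem ramanujanQ_zero : ramanujanQ 0 = 1 := by simp [ramanujanQ]

theorem ramanujanR_zero : ramanujanR 0 = 1 := by simp [ramanujanR]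

/-! ### Level-one modular forms as functions of the nome. -/

/-- The nome `e^{2πiτ}`. -/
noncomputable def nome (τ : ℂ) : ℂ := Complex.exp (2 * Real.pi * Complex.I * τ)

theorem norm_nome (τ : ℂ) : ‖nome τ‖ = Real.exp (-(2 * Real.pi * τ.im)) := by
  simp [nome, Complex.norm_exp]

theorem norm_nome_lt_one_iff {τ : ℂ} : ‖nome τ‖ < 1 ↔ 0 < τ.im := by
  rw [norm_nome, Real.exp_lt_one_iff]
  simp [Real.pi_pos]

theorem nome_ne_zero (τ : ℂ) : nome τ ≠ 0 := Complex.exp_ne_zero _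

theorem nome_add (τ w : ℂ) : nome (τ + w) = nome τ * nome w := by
  rw [nome, mul_add, Complex.exp_add]
  rfl

theorem hasDerivAt_nome (τ : ℂ) :
    HasDerivAt nome (2 * Real.pi * Complex.I * nome τ) τ := by
  have := ((hasDerivAt_id τ).const_mul (2 * Real.pi * Complex.I)).cexp
  convert! this using 1
  simp [nome, mul_comm]

theorem exists_nome_eq {q : ℂ} (h0 : q ≠ 0) (h1 : ‖q‖ < 1) : ∃ τ : UpperHalfPlane, nome τ = q := by
  have h : nome (Complex.log q / (2 * Real.pi * Complex.I)) = q := by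
    rw [nome, mul_div_cancel₀, Complex.exp_log h0]
    simp [Real.pi_ne_zero]
  refine ⟨⟨Complex.log q / (2 * Real.pi * Complex.I), ?_⟩, h⟩
  rw [← norm_nome_lt_one_iff, h]
  exact h1

open ModularForm EisensteinSeries

theorem E2_eq_ramanujanP (τ : UpperHalfPlane) : E2 τ = ramanujanP (nome τ) := by
  rw [ramanujanP_eq (norm_nome_lt_one_iff.2 τ.im_pos), E2_eq_tsum_cexp]
  rfl

theorem E₄_eq_ramanujanQ (τ : UpperHalfPlane) : E₄ τ = ramanujanQ (nome τ) := by
  rw [ramanujanQ_eq (norm_nome_lt_one_iff.2 τ.im_pos), q_expansion_bernoulli _ ⟨2, rfl⟩,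
    show bernoulli 4 = -1 / 30 by decide +kernel]
  norm_num [nome]

theorem E₆_eq_ramanujanR (τ : UpperHalfPlane) : E₆ τ = ramanujanR (nome τ) := by
  rw [ramanujanR_eq (norm_nome_lt_one_iff.2 τ.im_pos), q_expansion_bernoulli _ ⟨3, rfl⟩,
    show bernoulli 6 = 1 / 42 by decide +kernel]
  norm_num [nome]

open UpperHalfPlane in
theorem tendsto_nome_atImInfty : Tendsto (fun τ : UpperHalfPlane => nome τ) atImInfty (𝓝 0) := by
  rw [tendsto_zero_iff_norm_tendsto_zero]
  simp_rw [norm_nome]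
  refine Real.tendsto_exp_neg_atTop_nhds_zero.comp ?_
  exact Tendsto.const_mul_atTop (by positivity) tendsto_comap

open UpperHalfPlane Manifold in
theorem mdifferentiable_comp_nome {f : ℂ → ℂ} (hf : DifferentiableOn ℂ f (Metric.ball 0 1)) :
    MDiff (fun τ : UpperHalfPlane => f (nome τ)) := by
  rw [UpperHalfPlane.mdifferentiable_iff]
  have : DifferentiableOn ℂ (f ∘ nome) upperHalfPlaneSet :=
    hf.comp (fun z _ => (hasDerivAt_nome z).differentiableAt.differentiableWithinAt)
      (fun z hz => mem_ball_zero_iff.2 (norm_nome_lt_one_iff.2 hz))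
  refine this.congr fun z hz => ?_
  simp [ofComplex_apply_of_im_pos hz]

open UpperHalfPlane in
theorem normalizedDerivOfComplex_comp_nome {f : ℂ → ℂ}
    (hf : DifferentiableOn ℂ f (Metric.ball 0 1)) (τ : UpperHalfPlane) :
    Derivative.normalizedDerivOfComplex (fun τ : UpperHalfPlane => f (nome τ)) τ =
      nome τ * deriv f (nome τ) := by
  have h : (fun τ : UpperHalfPlane => f (nome τ)) ∘ ofComplex =ᶠ[𝓝 (τ : ℂ)] f ∘ nome := by
    filter_upwards [isOpen_upperHalfPlaneSet.mem_nhds τ.im_pos] with w hw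
    simp [ofComplex_apply_of_im_pos hw]
  have hd := (hf.differentiableAt (Metric.isOpen_ball.mem_nhds
    (mem_ball_zero_iff.2 (norm_nome_lt_one_iff.2 τ.im_pos)))).hasDerivAt.comp (τ : ℂ)
    (hasDerivAt_nome τ)
  rw [Derivative.normalizedDerivOfComplex, h.deriv_eq, hd.deriv]
  have : (2 * Real.pi * Complex.I : ℂ) ≠ 0 := by simp [Real.pi_ne_zero]
  rw [mul_left_comm (deriv f (nome τ)), inv_mul_cancel_left₀ this, mul_comm]

theorem tendsto_comp_nome {g : ℂ → ℂ} (hg : DifferentiableOn ℂ g (Metric.ball 0 1)) :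
    Tendsto (fun τ : UpperHalfPlane => g (nome τ)) UpperHalfPlane.atImInfty (𝓝 (g 0)) :=
  (hg.differentiableAt (Metric.ball_mem_nhds 0 one_pos)).continuousAt.tendsto.comp
    tendsto_nome_atImInfty

open UpperHalfPlane MatrixGroups in
/-- A level one modular form built from a holomorphic function of the nome. -/
noncomputable def modularFormOfNome (k : ℤ) (g : ℂ → ℂ)
    (hg : DifferentiableOn ℂ g (Metric.ball 0 1))
    (hslash : ∀ γ : SL(2, ℤ), (fun τ : UpperHalfPlane => g (nome τ)) ∣[k] γ = fun τ : UpperHalfPlane => g (nome τ)) :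
    ModularForm 𝒮ℒ k where
  toFun τ := g (nome τ)
  slash_action_eq' A hA := by
    obtain ⟨A, rfl⟩ := hA
    exact hslash A
  holo' := mdifferentiable_comp_nome hg
  bdd_at_cusps' hc := by
    rw [Subgroup.IsArithmetic.isCusp_iff_isCusp_SL2Z] at hc
    rw [OnePoint.isBoundedAt_iff_forall_SL2Z hc]
    intro γ _
    rw [hslash γ]
    exact (tendsto_comp_nome hg).isBigO_one ℝ

-- In a one-dimensional space of forms two elements are proportional, and the factor is seen at the
-- cusp q = 0. Each of Ramanujan's equations thereby reduces to a comparison of constant terms.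
open UpperHalfPlane MatrixGroups in
theorem eq_const_mul_of_rank_eq_one {k : ℤ} (hk : Module.rank ℂ (ModularForm 𝒮ℒ k) = 1)
    {g e : ℂ → ℂ} (hg : DifferentiableOn ℂ g (Metric.ball 0 1))
    (hslash : ∀ γ : SL(2, ℤ), (fun τ : UpperHalfPlane => g (nome τ)) ∣[k] γ = fun τ : UpperHalfPlane => g (nome τ))
    (he : DifferentiableOn ℂ e (Metric.ball 0 1))
    (heslash : ∀ γ : SL(2, ℤ), (fun τ : UpperHalfPlane => e (nome τ)) ∣[k] γ = fun τ : UpperHalfPlane => e (nome τ))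
    (he0 : e 0 = 1) {q : ℂ} (hq : ‖q‖ < 1) : g q = g 0 * e q := by
  have hne : modularFormOfNome k e he heslash ≠ 0 := by
    intro h
    have h0 : ∀ τ : UpperHalfPlane, e (nome τ) = 0 := fun τ : UpperHalfPlane => DFunLike.congr_fun h τ
    have := tendsto_nhds_unique (tendsto_comp_nome he) (tendsto_const_nhds.congr fun τ => (h0 τ).symm)
    rw [he0] at this
    exact one_ne_zero this
  obtain ⟨c, hc⟩ := (finrank_eq_one_iff_of_nonzero' _ hne).mp
    (Module.rank_eq_one_iff_finrank_eq_one.mp hk) (modularFormOfNome k g hg hslash)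
  have hc' : ∀ τ : UpperHalfPlane, c * e (nome τ) = g (nome τ) := fun τ : UpperHalfPlane => DFunLike.congr_fun hc τ
  have hlim := tendsto_nhds_unique (tendsto_comp_nome hg)
    (((tendsto_comp_nome he).const_mul c).congr hc')
  rw [he0, mul_one] at hlim
  rcases eq_or_ne q 0 with rfl | h0
  · rw [he0, mul_one]
  · obtain ⟨τ, rfl⟩ := exists_nome_eq h0 hq
    rw [hlim, hc']

theorem differentiableOn_id_mul_deriv {f : ℂ → ℂ} (hf : DifferentiableOn ℂ f (Metric.ball 0 1)) :
    DifferentiableOn ℂ (fun q => q * deriv f q) (Metric.ball 0 1) :=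
  differentiableOn_id.mul (hf.deriv Metric.isOpen_ball)

theorem coe_E2 : E2 = fun τ : UpperHalfPlane => ramanujanP (nome τ) := funext E2_eq_ramanujanP

theorem coe_E₄ : (E₄ : UpperHalfPlane → ℂ) = fun τ : UpperHalfPlane => ramanujanQ (nome τ) :=
  funext E₄_eq_ramanujanQ

theorem coe_E₆ : (E₆ : UpperHalfPlane → ℂ) = fun τ : UpperHalfPlane => ramanujanR (nome τ) :=
  funext E₆_eq_ramanujanR

open UpperHalfPlane MatrixGroups in
theorem ramanujanQ_slash (γ : SL(2, ℤ)) :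
    (fun τ : UpperHalfPlane => ramanujanQ (nome τ)) ∣[(4 : ℤ)] γ = fun τ : UpperHalfPlane => ramanujanQ (nome τ) := by
  rw [← coe_E₄]
  exact SlashInvariantFormClass.slash_action_eq E₄ _ ⟨γ, rfl⟩

open UpperHalfPlane MatrixGroups in
theorem ramanujanR_slash (γ : SL(2, ℤ)) :
    (fun τ : UpperHalfPlane => ramanujanR (nome τ)) ∣[(6 : ℤ)] γ = fun τ : UpperHalfPlane => ramanujanR (nome τ) := by
  rw [← coe_E₆]
  exact SlashInvariantFormClass.slash_action_eq E₆ _ ⟨γ, rfl⟩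

open UpperHalfPlane MatrixGroups in
theorem ramanujanQ_sq_slash (γ : SL(2, ℤ)) :
    (fun τ : UpperHalfPlane => ramanujanQ (nome τ) ^ 2) ∣[(8 : ℤ)] γ =
      fun τ : UpperHalfPlane => ramanujanQ (nome τ) ^ 2 := by
  have := mul_slash_SL2 4 4 γ (fun τ : UpperHalfPlane => ramanujanQ (nome τ))
    (fun τ : UpperHalfPlane => ramanujanQ (nome τ))
  rw [ramanujanQ_slash] at this
  simpa only [sq] using! this

/-! ### Ramanujan's differential equations. -/

/-- Ramanujan's differential equation for `Q`. -/
theorem mul_deriv_ramanujanQ {q : ℂ} (hq : ‖q‖ < 1) :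
    q * deriv ramanujanQ q = (ramanujanP q * ramanujanQ q - ramanujanR q) / 3 := by
  have hdiff : DifferentiableOn ℂ
      (fun q => q * deriv ramanujanQ q - 4 * 12⁻¹ * ramanujanP q * ramanujanQ q)
      (Metric.ball 0 1) :=
    (differentiableOn_id_mul_deriv differentiableOn_ramanujanQ).sub
      ((differentiableOn_ramanujanP.const_mul _).mul differentiableOn_ramanujanQ)
  -- The Serre derivative D - (k/12)E₂ raises the weight by 2, so this is a level-one form of weight
  -- 6, a multiple of R; its constant term is -1/3.
  have heq : Derivative.serreDerivative ((4 : ℤ) : ℂ)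
      (fun τ : UpperHalfPlane => ramanujanQ (nome τ)) = fun τ : UpperHalfPlane =>
        nome τ * deriv ramanujanQ (nome τ) - 4 * 12⁻¹ * ramanujanP (nome τ) * ramanujanQ (nome τ) := by
    funext τ
    rw [Derivative.serreDerivative_apply, E2_eq_ramanujanP,
      normalizedDerivOfComplex_comp_nome differentiableOn_ramanujanQ]
    norm_num
  have := eq_const_mul_of_rank_eq_one levelOne_weight_six_rank_one hdiff (fun γ => by
    rw [← heq]
    exact Derivative.serreDerivative_slash_invariant
      (mdifferentiable_comp_nome differentiableOn_ramanujanQ) (ramanujanQ_slash γ))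
    differentiableOn_ramanujanR ramanujanR_slash ramanujanR_zero hq
  simp only [ramanujanP_zero, ramanujanQ_zero] at this
  linear_combination this

/-- Ramanujan's differential equation for `R`. -/
theorem mul_deriv_ramanujanR {q : ℂ} (hq : ‖q‖ < 1) :
    q * deriv ramanujanR q = (ramanujanP q * ramanujanR q - ramanujanQ q ^ 2) / 2 := by
  have hdiff : DifferentiableOn ℂ
      (fun q => q * deriv ramanujanR q - 6 * 12⁻¹ * ramanujanP q * ramanujanR q)
      (Metric.ball 0 1) :=
    (differentiableOn_id_mul_deriv differentiableOn_ramanujanR).sub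
      ((differentiableOn_ramanujanP.const_mul _).mul differentiableOn_ramanujanR)
  have heq : Derivative.serreDerivative ((6 : ℤ) : ℂ)
      (fun τ : UpperHalfPlane => ramanujanR (nome τ)) = fun τ : UpperHalfPlane =>
        nome τ * deriv ramanujanR (nome τ) - 6 * 12⁻¹ * ramanujanP (nome τ) * ramanujanR (nome τ) := by
    funext τ
    rw [Derivative.serreDerivative_apply, E2_eq_ramanujanP,
      normalizedDerivOfComplex_comp_nome differentiableOn_ramanujanR]
    norm_num
  -- The Serre derivative of R has weight 8, where Q² spans.
  have hrank : Module.rank ℂ (ModularForm (Matrix.SpecialLinearGroup.mapGL ℝ :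
      Matrix.SpecialLinearGroup (Fin 2) ℤ →* _).range 8) = 1 := by
    have := dimension_level_one 8 (by decide)
    simpa [Nat.ModEq] using this
  have := eq_const_mul_of_rank_eq_one hrank hdiff (fun γ => by
    rw [← heq]
    exact Derivative.serreDerivative_slash_invariant
      (mdifferentiable_comp_nome differentiableOn_ramanujanR) (ramanujanR_slash γ))
    (differentiableOn_ramanujanQ.pow 2) ramanujanQ_sq_slash (by simp [ramanujanQ_zero]) hq
  simp only [ramanujanP_zero, ramanujanR_zero, Pi.pow_apply] at this
  linear_combination this

open UpperHalfPlane MatrixGroups in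
theorem normalizedDerivOfComplex_D2 (γ : SL(2, ℤ)) (τ : UpperHalfPlane) :
    Derivative.normalizedDerivOfComplex (D2 γ) τ = -((γ 1 0 : ℂ) / denom γ τ) ^ 2 := by
  have h : D2 γ ∘ ofComplex =ᶠ[𝓝 (τ : ℂ)]
      fun w => 2 * Real.pi * Complex.I * γ 1 0 * (denom γ w) ^ (-1 : ℤ) := by
    filter_upwards [isOpen_upperHalfPlaneSet.mem_nhds τ.im_pos] with w hw
    simp [ofComplex_apply_of_im_pos hw, D2, div_eq_mul_inv]
  have hd := (hasDerivAt_denom_zpow (γ : GL (Fin 2) ℝ) (-1) τ).const_mul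
    (2 * Real.pi * Complex.I * γ 1 0)
  rw [Derivative.normalizedDerivOfComplex, h.deriv_eq, hd.deriv]
  have hne : denom γ τ ≠ 0 := denom_ne_zero _ τ
  have hpi : (Real.pi : ℂ) ≠ 0 := by simp [Real.pi_ne_zero]
  have e : (denom γ τ) ^ (-1 - 1 : ℤ) = ((denom γ τ) ^ 2)⁻¹ := by
    rw [show (-1 - 1 : ℤ) = -((2 : ℕ) : ℤ) by norm_num, zpow_neg, zpow_natCast]
  simp only [e]
  simp
  field_simp
  rw [Complex.I_sq]
  ring

open UpperHalfPlane MatrixGroups Manifold in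
theorem mdifferentiable_D2 (γ : SL(2, ℤ)) : MDiff (D2 γ) := by
  rw [UpperHalfPlane.mdifferentiable_iff]
  have : DifferentiableOn ℂ (fun w => 2 * Real.pi * Complex.I * γ 1 0 * (denom γ w) ^ (-1 : ℤ))
      upperHalfPlaneSet := fun w hw =>
    ((hasDerivAt_denom_zpow (γ : GL (Fin 2) ℝ) (-1) ⟨w, hw⟩).const_mul
      (2 * Real.pi * Complex.I * γ 1 0)).differentiableAt.differentiableWithinAt
  refine this.congr fun w hw => ?_
  simp [ofComplex_apply_of_im_pos hw, D2, div_eq_mul_inv]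

-- E₂ is only quasimodular: under γ it gains a multiple of j = c/(cτ+d). The resulting terms in j E₂
-- and j² are the same in D E₂ and in E₂²/12, so they cancel. The coefficient is 1/12, half of the
-- Serre coefficient 2/12.
open UpperHalfPlane MatrixGroups in
theorem normalizedDerivOfComplex_E2_sub_slash (γ : SL(2, ℤ)) :
    (fun τ => Derivative.normalizedDerivOfComplex E2 τ - 12⁻¹ * E2 τ ^ 2) ∣[(4 : ℤ)] γ =
      fun τ => Derivative.normalizedDerivOfComplex E2 τ - 12⁻¹ * E2 τ ^ 2 := by
  funext τ
  have hE := congrFun (E2_slash_action γ) τ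
  have hD := congrFun (Derivative.normalizedDerivOfComplex_SL_slash (k := 2)
    E2_mdifferentiable (γ := γ)) τ
  have hD2 := mdifferentiable_D2 γ
  rw [E2_slash_action, Derivative.normalizedDerivOfComplex_sub _ _ E2_mdifferentiable
    (hD2.const_smul _), Derivative.normalizedDerivOfComplex_smul _ _ hD2] at hD
  simp only [Pi.sub_apply, Pi.smul_apply, smul_eq_mul, normalizedDerivOfComplex_D2, SL_slash_apply,
    riemannZeta_two, D2] at hE hD ⊢
  have hne : denom γ τ ≠ 0 := denom_ne_zero _ τ
  have hpi : (Real.pi : ℂ) ≠ 0 := by simp [Real.pi_ne_zero]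
  have e4 : (denom γ τ) ^ (-4 : ℤ) = ((denom γ τ) ^ (-2 : ℤ)) ^ 2 := by
    rw [← zpow_natCast, ← zpow_mul]
    norm_num
  norm_num at hD
  rw [sub_mul, mul_assoc, e4, ← mul_pow, hE, ← e4]
  have hI : Complex.I ^ 2 = -1 := Complex.I_sq
  rw [ModularGroup.sl_moeb, show (denom γ τ) ^ (-4 : ℤ) = ((denom γ τ) ^ 4)⁻¹ by
    rw [show (-4 : ℤ) = -((4 : ℕ) : ℤ) by norm_num, zpow_neg, zpow_natCast]]
  rw [mul_div_assoc (2 * Real.pi * Complex.I) (γ 1 0 : ℂ)] at hD ⊢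
  generalize (γ 1 0 : ℂ) / denom γ τ = j at hD ⊢
  rw [← sub_eq_iff_eq_add] at hD
  rw [← hD]
  field_simp
  ring_nf
  rw [hI]
  ring

/-- Ramanujan's differential equation for `P`. -/
theorem mul_deriv_ramanujanP {q : ℂ} (hq : ‖q‖ < 1) :
    q * deriv ramanujanP q = (ramanujanP q ^ 2 - ramanujanQ q) / 12 := by
  have hdiff : DifferentiableOn ℂ
      (fun q => q * deriv ramanujanP q - 12⁻¹ * ramanujanP q ^ 2) (Metric.ball 0 1) :=
    (differentiableOn_id_mul_deriv differentiableOn_ramanujanP).sub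
      ((differentiableOn_ramanujanP.pow 2).const_mul _)
  have heq : (fun τ => Derivative.normalizedDerivOfComplex E2 τ - 12⁻¹ * E2 τ ^ 2) =
      fun τ : UpperHalfPlane =>
        nome τ * deriv ramanujanP (nome τ) - 12⁻¹ * ramanujanP (nome τ) ^ 2 := by
    funext τ
    rw [E2_eq_ramanujanP, coe_E2, normalizedDerivOfComplex_comp_nome differentiableOn_ramanujanP]
  have := eq_const_mul_of_rank_eq_one levelOne_weight_four_rank_one hdiff (fun γ => by
    rw [← heq]
    exact normalizedDerivOfComplex_E2_sub_slash γ)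
    differentiableOn_ramanujanQ ramanujanQ_slash ramanujanQ_zero hq
  simp only [ramanujanP_zero] at this
  linear_combination this

/-! ### The discriminant and a lower bound for Q and R. -/

/-- The product `∏ (1 - qⁿ)²⁴`. -/
noncomputable def eulerProd24 (q : ℂ) : ℂ := ∏' n : ℕ, (1 - q ^ (n + 1)) ^ 24

theorem continuousAt_eulerProd24_zero : ContinuousAt eulerProd24 0 :=
  ((differentiableOn_tprod_one_sub_pow_pow 24).differentiableAt
    (Metric.ball_mem_nhds 0 one_pos)).continuousAt

theorem eulerProd24_zero : eulerProd24 0 = 1 := by simp [eulerProd24]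

theorem ramanujanQ_cube_sub_ramanujanR_sq_nome (τ : UpperHalfPlane) :
    ramanujanQ (nome τ) ^ 3 - ramanujanR (nome τ) ^ 2 = 1728 * eta τ ^ 24 := by
  have h := discriminant_eq_E₄_cube_sub_E₆_sq τ
  rw [E₄_eq_ramanujanQ, E₆_eq_ramanujanR, ModularForm.discriminant] at h
  rw [h]
  ring

theorem ramanujanQ_cube_sub_ramanujanR_sq {q : ℂ} (hq : ‖q‖ < 1) :
    ramanujanQ q ^ 3 - ramanujanR q ^ 2 = 1728 * (q * eulerProd24 q) := by
  rcases eq_or_ne q 0 with rfl | h0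
  · simp [ramanujanQ_zero, ramanujanR_zero]
  · obtain ⟨τ, rfl⟩ := exists_nome_eq h0 hq
    rw [ramanujanQ_cube_sub_ramanujanR_sq_nome]
    have := discriminant_eq_q_prod τ
    rw [ModularForm.discriminant] at this
    rw [this]
    simp [Function.Periodic.qParam, eta_q, nome, eulerProd24]

open UpperHalfPlane MatrixGroups in
theorem ramanujanQ_smul (γ : SL(2, ℤ)) (τ : UpperHalfPlane) :
    ramanujanQ (nome (γ • τ : UpperHalfPlane)) = denom γ τ ^ 4 * ramanujanQ (nome τ) := by
  have h := congrFun (ramanujanQ_slash γ) τ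
  rw [SL_slash_apply, zpow_neg, ← div_eq_mul_inv,
    div_eq_iff (zpow_ne_zero _ (denom_ne_zero _ _))] at h
  rw [h, mul_comm]
  norm_cast

open UpperHalfPlane MatrixGroups in
theorem ramanujanR_smul (γ : SL(2, ℤ)) (τ : UpperHalfPlane) :
    ramanujanR (nome (γ • τ : UpperHalfPlane)) = denom γ τ ^ 6 * ramanujanR (nome τ) := by
  have h := congrFun (ramanujanR_slash γ) τ
  rw [SL_slash_apply, zpow_neg, ← div_eq_mul_inv,
    div_eq_iff (zpow_ne_zero _ (denom_ne_zero _ _))] at h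
  rw [h, mul_comm]
  norm_cast

theorem continuousOn_ramanujanQ_nome :
    Continuous fun τ : UpperHalfPlane => ramanujanQ (nome τ) :=
  (mdifferentiable_comp_nome differentiableOn_ramanujanQ).continuous

theorem continuousOn_ramanujanR_nome :
    Continuous fun τ : UpperHalfPlane => ramanujanR (nome τ) :=
  (mdifferentiable_comp_nome differentiableOn_ramanujanR).continuous

open UpperHalfPlane ModularGroup in
/-- The `SL(2, ℤ)`-invariant function `y⁶ (|Q|³ + |R|²)` is bounded away from zero. -/
theorem exists_le_im_pow_mul_ramanujan :
    ∃ c : ℝ, 0 < c ∧ ∀ τ : UpperHalfPlane,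
      c ≤ τ.im ^ 6 * (‖ramanujanQ (nome τ)‖ ^ 3 + ‖ramanujanR (nome τ)‖ ^ 2) := by
  set N : UpperHalfPlane → ℝ := fun τ =>
    τ.im ^ 6 * (‖ramanujanQ (nome τ)‖ ^ 3 + ‖ramanujanR (nome τ)‖ ^ 2) with hN
  -- A common zero of Q and R would be a zero of Q³ - R² = 1728 η²⁴.
  have hpos : ∀ τ, 0 < N τ := by
    intro τ
    refine mul_pos (pow_pos τ.im_pos 6) (lt_of_le_of_ne (by positivity) fun h => ?_)
    have h1 : ramanujanQ (nome τ) = 0 := by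
      have : ‖ramanujanQ (nome τ)‖ ^ 3 = 0 := by
        nlinarith [pow_nonneg (norm_nonneg (ramanujanQ (nome τ))) 3,
          sq_nonneg ‖ramanujanR (nome τ)‖]
      simpa using this
    have h2 : ramanujanR (nome τ) = 0 := by
      rw [h1] at h
      simpa using h.symm
    have := ramanujanQ_cube_sub_ramanujanR_sq_nome τ
    rw [h1, h2] at this
    have h3 := eta_ne_zero τ.im_pos
    simp [h3] at this
  have hcont : Continuous N := by
    have := continuousOn_ramanujanQ_nome
    have := continuousOn_ramanujanR_nome
    have := UpperHalfPlane.continuous_im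
    fun_prop
  -- |Q|³ and |R|² both pick up |cτ+d|¹², which y⁶ compensates.
  have hinv : ∀ (γ : Matrix.SpecialLinearGroup (Fin 2) ℤ) (τ : UpperHalfPlane),
      N (γ • τ) = N τ := by
    intro γ τ
    have hne : ‖denom γ τ‖ ≠ 0 := norm_ne_zero_iff.2 (denom_ne_zero _ _)
    simp only [hN, ramanujanQ_smul, ramanujanR_smul, ModularGroup.im_smul_eq_div_normSq,
      Complex.normSq_eq_norm_sq, norm_mul, norm_pow]
    field_simp
  -- High in the fundamental domain |Q| > 1/2 and y ≥ 1, which gives the bound 1/8; the rest of the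
  -- domain is compact.
  have hlim := (tendsto_comp_nome differentiableOn_ramanujanQ).norm
  rw [ramanujanQ_zero, norm_one] at hlim
  have hev := hlim.eventually (lt_mem_nhds (show (1 / 2 : ℝ) < 1 by norm_num))
  rw [atImInfty, eventually_comap] at hev
  obtain ⟨Y, hY⟩ := eventually_atTop.1 hev
  obtain ⟨a, ha, haK⟩ := (isCompact_truncatedFundamentalDomain (max Y 1)).exists_forall_le'
    hcont.continuousOn (a := 0) (fun τ _ => hpos τ)
  refine ⟨min a (1 / 8), by positivity, fun τ => ?_⟩
  obtain ⟨γ, hγ⟩ := exists_smul_mem_fd τ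
  change _ ≤ N τ
  rw [← hinv γ τ]
  rcases le_or_gt (γ • τ).im (max Y 1) with h | h
  · exact (min_le_left _ _).trans (haK _ ⟨hγ, h⟩)
  · refine (min_le_right _ _).trans ?_
    have h1 := hY _ ((le_max_left _ _).trans h.le) (γ • τ) rfl
    have h2 : (1 : ℝ) ≤ (γ • τ).im ^ 6 := one_le_pow₀ ((le_max_right _ _).trans h.le)
    have h3 : (1 / 2 : ℝ) ^ 3 ≤ ‖ramanujanQ (nome (γ • τ : UpperHalfPlane))‖ ^ 3 := by
      gcongr
    calc (1 / 8 : ℝ) ≤ 1 * (‖ramanujanQ (nome (γ • τ : UpperHalfPlane))‖ ^ 3 +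
          ‖ramanujanR (nome (γ • τ : UpperHalfPlane))‖ ^ 2) := by
          nlinarith [sq_nonneg ‖ramanujanR (nome (γ • τ : UpperHalfPlane))‖]
      _ ≤ N (γ • τ) := by
          simp only [hN]
          gcongr

/-! ### Injectivity of Q near q = 0, and its zero at ω. -/

theorem norm_pow_sub_pow_le {a b : ℂ} {r : ℝ} (ha : ‖a‖ ≤ r) (hb : ‖b‖ ≤ r) (m : ℕ) :
    ‖a ^ (m + 1) - b ^ (m + 1)‖ ≤ (m + 1) * r ^ m * ‖a - b‖ := by
  have hr : 0 ≤ r := (norm_nonneg a).trans ha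
  induction m with
  | zero => simp
  | succ m ih =>
    have e : a ^ (m + 1 + 1) - b ^ (m + 1 + 1) =
        a * (a ^ (m + 1) - b ^ (m + 1)) + (a - b) * b ^ (m + 1) := by ring
    rw [e]
    refine (norm_add_le _ _).trans ?_
    rw [norm_mul, norm_mul, norm_pow]
    calc ‖a‖ * ‖a ^ (m + 1) - b ^ (m + 1)‖ + ‖a - b‖ * ‖b‖ ^ (m + 1)
        ≤ r * ((m + 1) * r ^ m * ‖a - b‖) + ‖a - b‖ * r ^ (m + 1) := by gcongr
      _ = _ := by push_cast; ring

/-- Consecutive fifth powers grow by at most (3/2)⁵ = 243/32 < 8. This turns the tail of Q on |q| ≤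
1/100 into a geometric series of ratio 8/100. -/
theorem add_two_pow_five_le (n : ℕ) : (n + 2) ^ 5 ≤ 32 * 8 ^ n := by
  induction n with
  | zero => norm_num
  | succ n ih =>
    have : (n + 1 + 2) ^ 5 ≤ 8 * (n + 2) ^ 5 := by
      have h : (n + 1 + 2) ^ 5 * 2 ^ 5 ≤ 8 * (n + 2) ^ 5 * 2 ^ 5 := by
        have : 2 * (n + 3) ≤ 3 * (n + 2) := by omega
        calc (n + 1 + 2) ^ 5 * 2 ^ 5 = (2 * (n + 3)) ^ 5 := by ring
          _ ≤ (3 * (n + 2)) ^ 5 := by gcongr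
          _ = 243 * (n + 2) ^ 5 := by ring
          _ ≤ 8 * (n + 2) ^ 5 * 2 ^ 5 := by nlinarith [Nat.zero_le ((n + 2) ^ 5)]
      omega
    calc (n + 1 + 2) ^ 5 ≤ 8 * (n + 2) ^ 5 := this
      _ ≤ 8 * (32 * 8 ^ n) := by gcongr
      _ = 32 * 8 ^ (n + 1) := by ring

-- Write Q = 1 + 240(q + tail). With σ₃(n) ≤ n⁴, the tail has Lipschitz constant at most (32/100)/(1
-- - 8/100) < 1, so q + tail is injective.
open ArithmeticFunction in
theorem ramanujanQ_injOn : Set.InjOn ramanujanQ (Metric.closedBall 0 (1 / 100)) := by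
  intro a ha b hb hab
  rw [mem_closedBall_zero_iff] at ha hb
  have ha1 : ‖a‖ < 1 := ha.trans_lt (by norm_num)
  have hb1 : ‖b‖ < 1 := hb.trans_lt (by norm_num)
  have hs (c : ℂ) (hc : ‖c‖ < 1) : Summable fun n : ℕ => (sigma 3 (n + 1) : ℂ) * c ^ (n + 1) := by
    rw [← summable_pnat_iff_summable_succ (f := fun n => (sigma 3 n : ℂ) * c ^ n)]
    refine Summable.of_norm ((summable_sigma_mul_pow 3 (norm_nonneg c) hc).congr fun n => ?_)
    simp
  have hsplit (c : ℂ) (hc : ‖c‖ < 1) : ramanujanQ c =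
      1 + 240 * (c + ∑' n : ℕ, (sigma 3 (n + 2) : ℂ) * c ^ (n + 2)) := by
    rw [ramanujanQ_eq hc, tsum_pnat_eq_tsum_succ (f := fun n => (sigma 3 n : ℂ) * c ^ n),
      (hs c hc).tsum_eq_zero_add]
    simp
  rw [hsplit a ha1, hsplit b hb1] at hab
  have hs2 (c : ℂ) (hc : ‖c‖ < 1) : Summable fun n : ℕ => (sigma 3 (n + 2) : ℂ) * c ^ (n + 2) :=
    (summable_nat_add_iff 1).2 (hs c hc)
  have hab' : a - b = ∑' n : ℕ, (sigma 3 (n + 2) : ℂ) * (b ^ (n + 2) - a ^ (n + 2)) := by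
    simp_rw [mul_sub]
    rw [(hs2 b hb1).tsum_sub (hs2 a ha1)]
    linear_combination hab / 240
  have hbound : ‖a - b‖ ≤ (32 / 100 * ‖a - b‖) * (1 - 8 / 100)⁻¹ := by
    conv_lhs => rw [hab']
    refine tsum_of_norm_bounded ((hasSum_geometric_of_lt_one (r := (8 / 100 : ℝ)) (by norm_num)
      (by norm_num)).mul_left (32 / 100 * ‖a - b‖)) fun n => ?_
    rw [norm_mul, Complex.norm_natCast, norm_sub_rev]
    have h1 := norm_pow_sub_pow_le ha hb (n + 1)
    have h2 : (sigma 3 (n + 2) : ℝ) ≤ (n + 2) ^ 4 := by exact_mod_cast sigma_le_pow_succ 3 (n + 2)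
    have h3 : ((n : ℝ) + 2) ^ 5 ≤ 32 * 8 ^ n := by exact_mod_cast add_two_pow_five_le n
    calc (sigma 3 (n + 2) : ℝ) * ‖a ^ (n + 2) - b ^ (n + 2)‖
        ≤ (n + 2) ^ 4 * (((n + 1 : ℕ) + 1) * (1 / 100) ^ (n + 1) * ‖a - b‖) := by gcongr
      _ = ((n : ℝ) + 2) ^ 5 * ((1 / 100) ^ (n + 1) * ‖a - b‖) := by push_cast; ring
      _ ≤ (32 * 8 ^ n) * ((1 / 100) ^ (n + 1) * ‖a - b‖) := by gcongr
      _ = 32 / 100 * ‖a - b‖ * (8 / 100) ^ n := by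
        rw [div_pow, div_pow, one_pow]
        field_simp
        ring
  have : ‖a - b‖ = 0 := by
    have := norm_nonneg (a - b)
    norm_num at hbound
    linarith
  rwa [norm_eq_zero, sub_eq_zero] at this

/-- The primitive cube root of unity in the upper half-plane. -/
noncomputable def omega : UpperHalfPlane :=
  ⟨⟨-1 / 2, √3 / 2⟩, by simp⟩

theorem omega_sq_add : (omega : ℂ) ^ 2 + omega + 1 = 0 := by
  have h3 : (√3) ^ 2 = 3 := Real.sq_sqrt (by norm_num)
  apply Complex.ext
  · simp [omega, sq]
    nlinarith
  · simp [omega, sq]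
    ring

-- Since -1/ω = ω + 1, weight 4 and periodicity give Q = ω⁴ Q = ω Q at ω, with ω ≠ 1.
open ModularGroup UpperHalfPlane in
theorem ramanujanQ_nome_omega : ramanujanQ (nome omega) = 0 := by
  have h0 := omega_sq_add
  have hne : (omega : ℂ) ≠ 0 := UpperHalfPlane.ne_zero _
  have hT : nome ((T • omega : UpperHalfPlane) : ℂ) = nome omega := by
    rw [modular_T_smul, UpperHalfPlane.coe_vadd, nome_add]
    simp [nome, Complex.exp_two_pi_mul_I]
  have hST : S • omega = T • omega := by
    apply UpperHalfPlane.ext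
    rw [modular_S_smul, modular_T_smul]
    simp only [UpperHalfPlane.coe_vadd]
    refine inv_eq_of_mul_eq_one_right ?_
    push_cast
    linear_combination -h0
  have h := ramanujanQ_smul S omega
  rw [hST, hT, denom_S] at h
  have h4 : (omega : ℂ) ^ 4 = omega := by linear_combination (omega : ℂ) * (omega - 1) * h0
  rw [h4] at h
  have h1 : (omega : ℂ) - 1 ≠ 0 := by
    intro h1
    have : (omega : ℂ).im = 0 := by rw [sub_eq_zero.1 h1]; simp
    exact omega.im_ne_zero this
  have : ((omega : ℂ) - 1) * ramanujanQ (nome omega) = 0 := by linear_combination -h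
  exact (mul_eq_zero.1 this).resolve_left h1

/-- Places ω in the disc where Q is injective: 2π Im ω = π√3 > 5 and e⁵ > 100. -/
theorem norm_nome_omega_le : ‖nome omega‖ ≤ 1 / 100 := by
  rw [norm_nome]
  have h3 : (1.7 : ℝ) ≤ √3 := Real.le_sqrt_of_sq_le (by norm_num)
  have hpi := Real.pi_gt_three
  have h5 : (5 : ℝ) ≤ 2 * Real.pi * (omega : ℂ).im := by
    simp only [omega]
    nlinarith
  rw [Real.exp_neg, one_div]
  apply inv_anti₀ (by norm_num)
  calc (100 : ℝ) ≤ 2.7 ^ 5 := by norm_num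
    _ ≤ Real.exp 1 ^ 5 := by
      gcongr
      exact (by norm_num : (2.7 : ℝ) ≤ 2.7182818283).trans Real.exp_one_gt_d9.le
    _ = Real.exp 5 := by rw [← Real.exp_nat_mul]; norm_num
    _ ≤ _ := Real.exp_le_exp.2 h5

/-! ### The Γ²-invariant function R/η¹². -/

/-- The quotient `R / η¹²`, a modular function with a quadratic character. -/
noncomputable def ramanujanRDivEta (τ : ℂ) : ℂ := ramanujanR (nome τ) / eta τ ^ 12

/-- The sign comes from the prefactor q^{1/2} of η¹². -/
theorem ramanujanRDivEta_T_smul (τ : UpperHalfPlane) :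
    ramanujanRDivEta (ModularGroup.T • τ : UpperHalfPlane) = -ramanujanRDivEta τ := by
  have hT : nome ((ModularGroup.T • τ : UpperHalfPlane) : ℂ) = nome τ := by
    rw [UpperHalfPlane.modular_T_smul, UpperHalfPlane.coe_vadd, nome_add]
    simp [nome, Complex.exp_two_pi_mul_I]
  have hq : Function.Periodic.qParam 1 ((ModularGroup.T • τ : UpperHalfPlane) : ℂ) =
      Function.Periodic.qParam 1 τ := by
    simpa [nome, Function.Periodic.qParam] using hT
  have h24 : Function.Periodic.qParam 24 ((ModularGroup.T • τ : UpperHalfPlane) : ℂ) ^ 12 =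
      -Function.Periodic.qParam 24 τ ^ 12 := by
    rw [UpperHalfPlane.modular_T_smul, UpperHalfPlane.coe_vadd]
    simp only [Function.Periodic.qParam, ← Complex.exp_nat_mul]
    rw [← Complex.exp_add_pi_mul_I]
    congr 1
    push_cast
    ring
  simp only [ramanujanRDivEta, hT, eta, eta_q, hq, mul_pow, h24]
  rw [neg_mul, div_neg]

/-- Here η(-1/τ)¹² = (τ/i)⁶ η¹² = -τ⁶ η¹², against the factor τ⁶ of R. -/
theorem ramanujanRDivEta_S_smul (τ : UpperHalfPlane) :
    ramanujanRDivEta (ModularGroup.S • τ : UpperHalfPlane) = -ramanujanRDivEta τ := by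
  have hsq (z : ℂ) : Complex.sqrt z ^ 12 = z ^ 6 := by
    rw [Complex.sqrt, ← Complex.cpow_nat_mul, ← Complex.cpow_natCast]
    norm_num
  have hη : eta ((ModularGroup.S • τ : UpperHalfPlane) : ℂ) =
      (Complex.sqrt Complex.I)⁻¹ * (Complex.sqrt τ * eta τ) := by
    have := eta_comp_eq_csqrt_I_inv τ.2
    rw [UpperHalfPlane.modular_S_smul]
    change eta (-(τ : ℂ))⁻¹ = _
    rw [← neg_inv]
    simpa [neg_div] using this
  have hτ := UpperHalfPlane.ne_zero τ
  have hη0 := eta_ne_zero τ.im_pos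
  rw [ramanujanRDivEta, ramanujanR_smul, hη, ModularGroup.denom_S, mul_pow, mul_pow, inv_pow,
    hsq, hsq, show Complex.I ^ 6 = -1 by
      rw [show 6 = 4 + 2 by norm_num, pow_add, Complex.I_pow_four, Complex.I_sq, one_mul],
    ramanujanRDivEta]
  field_simp

/-- Each generator is a product of one S and one T, so the two signs cancel. -/
theorem ramanujanRDivEta_smul_of_mem {γ : Matrix.SpecialLinearGroup (Fin 2) ℤ} (hγ : γ ∈ GammaSq)
    (τ : UpperHalfPlane) :
    ramanujanRDivEta (γ • τ : UpperHalfPlane) = ramanujanRDivEta τ := by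
  rw [GammaSq_eq_closure] at hγ
  induction hγ using Subgroup.closure_induction generalizing τ with
  | one => rw [one_smul]
  | mem g hg =>
    rcases hg with rfl | rfl
    · rw [mul_smul, ramanujanRDivEta_S_smul, ramanujanRDivEta_T_smul, neg_neg]
    · rw [mul_smul, ramanujanRDivEta_T_smul, ramanujanRDivEta_S_smul, neg_neg]
  | mul g h _ _ ig ih => rw [mul_smul, ig, ih]
  | inv g _ ig => rw [← ig, smul_inv_smul]

theorem analyticOnNhd_eta : AnalyticOnNhd ℂ eta {z : ℂ | 0 < z.im} :=
  DifferentiableOn.analyticOnNhd (fun _ hz =>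
    (differentiableAt_eta_of_mem_upperHalfPlaneSet hz).differentiableWithinAt)
    (isOpen_lt continuous_const Complex.continuous_im)

theorem analyticOnNhd_comp_nome {f : ℂ → ℂ} (hf : DifferentiableOn ℂ f (Metric.ball 0 1)) :
    AnalyticOnNhd ℂ (fun z => f (nome z)) {z : ℂ | 0 < z.im} :=
  DifferentiableOn.analyticOnNhd (hf.comp
    (fun _ _ => (hasDerivAt_nome _).differentiableAt.differentiableWithinAt)
    (fun _ hz => mem_ball_zero_iff.2 (norm_nome_lt_one_iff.2 hz)))
    (isOpen_lt continuous_const Complex.continuous_im)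

theorem analyticOnNhd_ramanujanRDivEta : AnalyticOnNhd ℂ ramanujanRDivEta {z : ℂ | 0 < z.im} :=
  (analyticOnNhd_comp_nome differentiableOn_ramanujanR).div (analyticOnNhd_eta.pow 12)
    (fun _ hz => pow_ne_zero _ (eta_ne_zero hz))

end

/-! ### Euler's integral for the hypergeometric function. -/

section

open MeasureTheory Set

/-- The weight `t^{b-1} (1-t)^{d-1}` of the beta integral. -/
noncomputable def betaWeight (b d t : ℝ) : ℝ := t ^ (b - 1) * (1 - t) ^ (d - 1)

theorem betaWeight_pos (b d : ℝ) {t : ℝ} (ht : t ∈ Ioo (0 : ℝ) 1) : 0 < betaWeight b d t :=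
  mul_pos (Real.rpow_pos_of_pos ht.1 _) (Real.rpow_pos_of_pos (sub_pos.2 ht.2) _)

theorem ofReal_betaWeight (b d : ℝ) {t : ℝ} (ht : t ∈ Ioo (0 : ℝ) 1) :
    (betaWeight b d t : ℂ) = (t : ℂ) ^ ((b : ℂ) - 1) * (1 - (t : ℂ)) ^ ((d : ℂ) - 1) := by
  rw [betaWeight, Complex.ofReal_mul, Complex.ofReal_cpow ht.1.le,
    Complex.ofReal_cpow (sub_pos.2 ht.2).le]
  push_cast
  rfl

theorem integrableOn_betaWeight {b d : ℝ} (hb : 0 < b) (hd : 0 < d) :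
    IntegrableOn (betaWeight b d) (Ioo 0 1) := by
  have h := Complex.betaIntegral_convergent (u := b) (v := d) (by simpa) (by simpa)
  rw [intervalIntegrable_iff_integrableOn_Ioo_of_le zero_le_one] at h
  have h2 : IntegrableOn (fun t => (betaWeight b d t : ℂ)) (Ioo 0 1) :=
    h.congr_fun (fun t ht => (ofReal_betaWeight b d ht).symm) measurableSet_Ioo
  exact h2.re

theorem integral_ofReal_betaWeight (b d : ℝ) :
    ∫ t in Ioo (0 : ℝ) 1, (betaWeight b d t : ℂ) = Complex.betaIntegral b d := by
  rw [Complex.betaIntegral, intervalIntegral.integral_of_le zero_le_one, integral_Ioc_eq_integral_Ioo]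
  exact setIntegral_congr_fun measurableSet_Ioo fun t ht => ofReal_betaWeight b d ht

theorem ofReal_integral_betaWeight (b d : ℝ) :
    ((∫ t in Ioo (0 : ℝ) 1, betaWeight b d t : ℝ) : ℂ) = Complex.betaIntegral b d := by
  rw [← integral_ofReal_betaWeight, integral_complex_ofReal]

theorem setIntegral_Ioo_pos {f : ℝ → ℝ} (hf : IntegrableOn f (Ioo 0 1))
    (hpos : ∀ t ∈ Ioo (0 : ℝ) 1, 0 < f t) : 0 < ∫ t in Ioo (0 : ℝ) 1, f t := by
  rw [setIntegral_pos_iff_support_of_nonneg_ae]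
  · have : Function.support f ∩ Ioo 0 1 = Ioo 0 1 :=
      inter_eq_right.2 fun t ht => (hpos t ht).ne'
    rw [this]
    simp
  · exact (ae_restrict_iff' measurableSet_Ioo).2 (Eventually.of_forall fun t ht => (hpos t ht).le)
  · exact hf

theorem betaIntegral_ne_zero {b d : ℝ} (hb : 0 < b) (hd : 0 < d) : Complex.betaIntegral b d ≠ 0 := by
  rw [← ofReal_integral_betaWeight]
  exact_mod_cast (setIntegral_Ioo_pos (integrableOn_betaWeight hb hd)
    fun t ht => betaWeight_pos b d ht).ne'

/-- The plane cut along `[1, ∞)`. -/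
def slitOne : Set ℂ := {s : ℂ | 1 - s ∈ Complex.slitPlane}

theorem isOpen_slitOne : IsOpen slitOne :=
  Complex.isOpen_slitPlane.preimage (continuous_const.sub continuous_id)

theorem one_sub_mul_mem_slitPlane {s : ℂ} (hs : s ∈ slitOne) {t : ℝ} (ht : t ∈ Icc (0 : ℝ) 1) :
    1 - t * s ∈ Complex.slitPlane := by
  have := Complex.starConvex_one_slitPlane hs (sub_nonneg.2 ht.2) ht.1 (by ring)
  convert this using 1
  simp
  ring

theorem mem_slitOne_of_norm_lt_one {s : ℂ} (hs : ‖s‖ < 1) : s ∈ slitOne := by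
  have := Complex.mem_slitPlane_of_norm_lt_one (z := -s) (by simpa using hs)
  rwa [← sub_eq_add_neg] at this

/-- Euler's integral for the hypergeometric function `₂F₁(a, b; b + d; ·)`. -/
noncomputable def eulerIntegral (a b d : ℝ) (s : ℂ) : ℂ :=
  (Complex.betaIntegral b d)⁻¹ *
    ∫ t in Ioo (0 : ℝ) 1, (betaWeight b d t : ℂ) * (1 - t * s) ^ (-a : ℂ)

theorem continuousOn_one_sub_mul_cpow {K : Set ℂ} (hK : K ⊆ slitOne) (r : ℂ) :
    ContinuousOn (fun p : ℝ × ℂ => (1 - p.1 * p.2) ^ r) (Icc (0 : ℝ) 1 ×ˢ K) := by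
  intro p hp
  have h := one_sub_mul_mem_slitPlane (hK hp.2) hp.1
  refine ContinuousAt.continuousWithinAt ?_
  exact (ContinuousAt.cpow (by fun_prop) continuousAt_const h)

theorem aestronglyMeasurable_eulerIntegrand (b d : ℝ) (hb : 0 < b) (hd : 0 < d) (r : ℂ) {s : ℂ}
    (hs : s ∈ slitOne) : AEStronglyMeasurable
      (fun t : ℝ => (betaWeight b d t : ℂ) * (1 - t * s) ^ r) (volume.restrict (Ioo 0 1)) := by
  have h1 := (integrableOn_betaWeight hb hd).ofReal (𝕜 := ℂ) |>.aestronglyMeasurable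
  refine h1.mul (ContinuousOn.aestronglyMeasurable ?_ measurableSet_Ioo)
  exact (continuousOn_one_sub_mul_cpow (K := {s}) (by simpa using hs) r).comp
    (f := fun t : ℝ => (t, s)) (by fun_prop) (fun t ht => ⟨Ioo_subset_Icc_self ht, rfl⟩)

theorem integrableOn_eulerIntegrand {b d : ℝ} (hb : 0 < b) (hd : 0 < d) (r : ℂ) {s : ℂ}
    (hs : s ∈ slitOne) : IntegrableOn
      (fun t : ℝ => (betaWeight b d t : ℂ) * (1 - t * s) ^ r) (Ioo 0 1) := by
  obtain ⟨C, hC⟩ := (isCompact_Icc.prod isCompact_singleton).exists_bound_of_continuousOn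
    (continuousOn_one_sub_mul_cpow (K := {s}) (by simpa using hs) r)
  refine Integrable.mono' ((integrableOn_betaWeight hb hd).mul_const C)
    (aestronglyMeasurable_eulerIntegrand b d hb hd r hs) ?_
  refine (ae_restrict_iff' measurableSet_Ioo).2 (Eventually.of_forall fun t ht => ?_)
  rw [norm_mul, Complex.norm_real, Real.norm_of_nonneg (betaWeight_pos b d ht).le]
  exact mul_le_mul_of_nonneg_left (hC (t, s) ⟨Ioo_subset_Icc_self ht, rfl⟩)
    (betaWeight_pos b d ht).le

theorem differentiableOn_eulerIntegral (a : ℝ) {b d : ℝ} (hb : 0 < b) (hd : 0 < d) :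
    DifferentiableOn ℂ (eulerIntegral a b d) slitOne := by
  refine DifferentiableOn.const_mul (fun s hs => ?_) _
  obtain ⟨ε, hε, hball⟩ := Metric.nhds_basis_closedBall.mem_iff.1 (isOpen_slitOne.mem_nhds hs)
  obtain ⟨C, hC⟩ := (isCompact_Icc.prod (isCompact_closedBall s ε)).exists_bound_of_continuousOn
    (continuousOn_one_sub_mul_cpow hball (-a - 1 : ℂ))
  have hder (t : ℝ) (ht : t ∈ Ioo (0 : ℝ) 1) (x : ℂ) (hx : x ∈ slitOne) :
      HasDerivAt (fun x : ℂ => (betaWeight b d t : ℂ) * (1 - t * x) ^ (-a : ℂ))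
        ((betaWeight b d t : ℂ) * (a * t * (1 - t * x) ^ (-a - 1 : ℂ))) x := by
    have h1 : HasDerivAt (fun x : ℂ => 1 - t * x) (-t : ℂ) x := by
      simpa using ((hasDerivAt_id x).const_mul (t : ℂ)).const_sub 1
    have h2 := (h1.cpow_const (c := (-a : ℂ))
      (one_sub_mul_mem_slitPlane hx (Ioo_subset_Icc_self ht))).const_mul (betaWeight b d t : ℂ)
    convert! h2 using 1
    ring
  have key := hasDerivAt_integral_of_dominated_loc_of_deriv_le (𝕜 := ℂ)
    (μ := volume.restrict (Ioo (0 : ℝ) 1)) (x₀ := s) (s := Metric.closedBall s ε)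
    (F := fun x t => (betaWeight b d t : ℂ) * (1 - t * x) ^ (-a : ℂ))
    (F' := fun x t => (betaWeight b d t : ℂ) * (a * t * (1 - t * x) ^ (-a - 1 : ℂ)))
    (bound := fun t => betaWeight b d t * (|a| * C)) (Metric.closedBall_mem_nhds s hε)
    (by
      filter_upwards [isOpen_slitOne.mem_nhds hs] with x hx
      exact aestronglyMeasurable_eulerIntegrand b d hb hd _ hx)
    (integrableOn_eulerIntegrand hb hd _ hs)
    (by
      have h := aestronglyMeasurable_eulerIntegrand b d hb hd (-a - 1 : ℂ) hs
      have h2 : AEStronglyMeasurable (fun t : ℝ => (a * t : ℂ)) (volume.restrict (Ioo 0 1)) := by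
        exact Continuous.aestronglyMeasurable (by fun_prop)
      refine (h2.mul h).congr (Eventually.of_forall fun t => ?_)
      simp only [Pi.mul_apply]
      ring)
    ((ae_restrict_iff' measurableSet_Ioo).2 (Eventually.of_forall fun t ht x hx => by
      have hw := (betaWeight_pos b d ht).le
      rw [norm_mul, Complex.norm_real, Real.norm_of_nonneg hw]
      refine mul_le_mul_of_nonneg_left ?_ hw
      rw [norm_mul, norm_mul, Complex.norm_real, Complex.norm_real, Real.norm_eq_abs,
        Real.norm_of_nonneg ht.1.le]
      have h3 := hC (t, x) ⟨Ioo_subset_Icc_self ht, hx⟩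
      have h4 : |a| * t ≤ |a| := mul_le_of_le_one_right (abs_nonneg a) ht.2.le
      exact mul_le_mul h4 h3 (norm_nonneg _) (abs_nonneg a)))
    ((integrableOn_betaWeight hb hd).mul_const _)
    ((ae_restrict_iff' measurableSet_Ioo).2 (Eventually.of_forall fun t ht x hx =>
      hder t ht x (hball hx)))
  exact key.2.differentiableAt.differentiableWithinAt

/-- |arg z| < π, so the argument of the power stays below π/2 in absolute value. Integrated against
the positive beta weight, this keeps χ₁ away from zero on the whole slit plane. -/
theorem cpow_neg_re_pos {a : ℝ} (ha0 : 0 ≤ a) (ha : a ≤ 1 / 2) {z : ℂ} (hz : z ∈ Complex.slitPlane) :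
    0 < (z ^ (-a : ℂ)).re := by
  have hz0 := Complex.slitPlane_ne_zero hz
  have harg := Complex.mem_slitPlane_iff_arg.1 hz
  rw [Complex.cpow_def_of_ne_zero hz0, Complex.exp_re]
  refine mul_pos (Real.exp_pos _) ?_
  have him : (Complex.log z * (-a : ℂ)).im = -(a * z.arg) := by
    simp [Complex.log_im, mul_comm]
  rw [him, Real.cos_neg]
  have h1 : z.arg < Real.pi := lt_of_le_of_ne (Complex.arg_le_pi z) harg.1
  have h2 := Complex.neg_pi_lt_arg z
  apply Real.cos_pos_of_mem_Ioo
  have hpi := Real.pi_pos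
  rcases ha0.eq_or_lt with rfl | ha0
  · constructor <;> simp [hpi]
  constructor <;> nlinarith

theorem eulerIntegral_re_pos {a b d : ℝ} (ha0 : 0 ≤ a) (ha : a ≤ 1 / 2) (hb : 0 < b) (hd : 0 < d)
    {s : ℂ} (hs : s ∈ slitOne) : 0 < (eulerIntegral a b d s).re := by
  have hint := integrableOn_eulerIntegrand hb hd (-a : ℂ) hs
  rw [eulerIntegral, ← ofReal_integral_betaWeight, ← Complex.ofReal_inv, Complex.re_ofReal_mul]
  refine mul_pos (inv_pos.2 (setIntegral_Ioo_pos (integrableOn_betaWeight hb hd)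
    fun t ht => betaWeight_pos b d ht)) ?_
  have e : (∫ t in Ioo (0 : ℝ) 1, (betaWeight b d t : ℂ) * (1 - t * s) ^ (-a : ℂ)).re =
      ∫ t in Ioo (0 : ℝ) 1, ((betaWeight b d t : ℂ) * (1 - t * s) ^ (-a : ℂ)).re :=
    (integral_re hint).symm
  rw [e]
  refine setIntegral_Ioo_pos hint.re fun t ht => ?_
  simp only [Complex.re_ofReal_mul]
  exact mul_pos (betaWeight_pos b d ht)
    (cpow_neg_re_pos ha0 ha (one_sub_mul_mem_slitPlane hs (Ioo_subset_Icc_self ht)))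

/-- Gauss's summation as an Abelian limit: 1 - tx ≥ 1 - t makes the weight with exponent d - a a
dominating function, integrable because a < d. -/
theorem tendsto_eulerIntegral_one {a b d : ℝ} (ha0 : 0 ≤ a) (had : a < d) (hb : 0 < b) :
    Tendsto (fun x : ℝ => eulerIntegral a b d x) (𝓝[<] 1)
      (𝓝 ((Complex.betaIntegral b d)⁻¹ * Complex.betaIntegral b (d - a : ℝ))) := by
  have hd : 0 < d := ha0.trans_lt had
  refine Tendsto.const_mul _ ?_
  rw [← integral_ofReal_betaWeight]
  have hlt : ∀ᶠ x : ℝ in 𝓝[<] 1, x ∈ Ioo (0 : ℝ) 1 := Ioo_mem_nhdsLT zero_lt_one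
  have hw (t : ℝ) (ht : t ∈ Ioo (0 : ℝ) 1) :
      betaWeight b (d - a) t = betaWeight b d t * (1 - t) ^ (-a) := by
    rw [betaWeight, betaWeight, mul_assoc, ← Real.rpow_add (sub_pos.2 ht.2)]
    ring_nf
  refine tendsto_integral_filter_of_dominated_convergence (betaWeight b (d - a)) ?_ ?_
    (integrableOn_betaWeight hb (sub_pos.2 had)) ?_
  · filter_upwards [hlt] with x hx
    refine aestronglyMeasurable_eulerIntegrand b d hb hd _ (mem_slitOne_of_norm_lt_one ?_)
    rw [Complex.norm_real, Real.norm_of_nonneg hx.1.le]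
    exact hx.2
  · filter_upwards [hlt] with x hx
    refine (ae_restrict_iff' measurableSet_Ioo).2 (Eventually.of_forall fun t ht => ?_)
    have htx : t * x ≤ t := mul_le_of_le_one_right ht.1.le hx.2.le
    have hpos : 0 < 1 - t := sub_pos.2 ht.2
    rw [norm_mul, Complex.norm_real, Real.norm_of_nonneg (betaWeight_pos b d ht).le, hw t ht]
    refine mul_le_mul_of_nonneg_left ?_ (betaWeight_pos b d ht).le
    have e : (1 - t * x : ℂ) = ((1 - t * x : ℝ) : ℂ) := by push_cast; rfl
    rw [e, ← Complex.ofReal_neg, ← Complex.ofReal_cpow (by linarith), Complex.norm_real,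
      Real.norm_of_nonneg (Real.rpow_nonneg (by linarith) _)]
    exact Real.rpow_le_rpow_of_nonpos hpos (by linarith) (by linarith)
  · refine (ae_restrict_iff' measurableSet_Ioo).2 (Eventually.of_forall fun t ht => ?_)
    have hpos : 0 < 1 - t := sub_pos.2 ht.2
    have e : (betaWeight b (d - a) t : ℂ) = (betaWeight b d t : ℂ) * (1 - t * (1 : ℝ)) ^ (-a : ℂ) := by
      rw [hw t ht, Complex.ofReal_mul, Complex.ofReal_cpow hpos.le]
      push_cast
      ring_nf
    rw [e]
    have hc : ContinuousAt (fun x : ℝ => (betaWeight b d t : ℂ) * (1 - t * x) ^ (-a : ℂ)) 1 := by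
      refine continuousAt_const.mul (ContinuousAt.cpow (by fun_prop) continuousAt_const ?_)
      refine Or.inl ?_
      simpa using ht.2
    exact hc.tendsto.mono_left nhdsWithin_le_nhds

/-! ### Hypergeometric series: coefficients, termwise operations, differential equation. -/

/-- The (real) coefficients of the hypergeometric series. -/
noncomputable def hypCoeff (a b c : ℝ) : ℕ → ℝ
  | 0 => 1
  | n + 1 => hypCoeff a b c n * ((a + n) * (b + n) / ((n + 1) * (c + n)))

theorem ordinaryHypergeometricCoefficient_eq (a b c : ℝ) (n : ℕ) :
    ordinaryHypergeometricCoefficient (a : ℂ) b c n = hypCoeff a b c n := by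
  induction n with
  | zero => simp [hypCoeff, ordinaryHypergeometricCoefficient]
  | succ n ih =>
    rw [hypCoeff, Complex.ofReal_mul, ← ih]
    simp only [ordinaryHypergeometricCoefficient, ascPochhammer_succ_eval, Nat.factorial_succ]
    push_cast
    simp only [div_eq_mul_inv, mul_inv]
    ring

theorem ordinaryHypergeometric_eq (a b c : ℝ) (s : ℂ) :
    ordinaryHypergeometric (a : ℂ) b c s = ∑' n, (hypCoeff a b c n : ℂ) * s ^ n := by
  rw [ordinaryHypergeometric, ordinaryHypergeometric_sum_eq]
  refine tsum_congr fun n => ?_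
  rw [← ordinaryHypergeometricCoefficient_eq, smul_eq_mul]

theorem hypCoeff_mem_Icc {a b c : ℝ} (ha0 : 0 ≤ a) (ha : a ≤ 1) (hb0 : 0 ≤ b) (hb : b ≤ c)
    (hc : 0 < c) (n : ℕ) : hypCoeff a b c n ∈ Icc (0 : ℝ) 1 := by
  induction n with
  | zero => simp [hypCoeff]
  | succ n ih =>
    have h1 : (a + n) * (b + n) / ((n + 1) * (c + n)) ≤ 1 := by
      rw [div_le_one (by positivity)]
      have : a + n ≤ n + 1 := by linarith
      gcongr
    rw [hypCoeff]
    exact ⟨mul_nonneg ih.1 (by positivity), mul_le_one₀ ih.2 (by positivity) h1⟩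

theorem hasSum_one_sub_cpow_neg (a : ℝ) {x : ℂ} (hx : ‖x‖ < 1) :
    HasSum (fun n => (hypCoeff a 1 1 n : ℂ) * x ^ n) ((1 - x) ^ (-a : ℂ)) := by
  have h := (Complex.one_add_cpow_hasFPowerSeriesOnBall_zero (a := (-a : ℂ))).hasSum
    (y := -x) (by simpa [enorm_eq_nnnorm, ← NNReal.coe_lt_coe] using hx)
  rw [zero_add, ← sub_eq_add_neg] at h
  convert! h using 2 with n
  rw [binomialSeries_eq_ordinaryHypergeometricSeries (b := (1 : ℂ)) (fun k => by
      rw [ne_eq, eq_neg_iff_add_eq_zero]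
      exact_mod_cast k.succ_ne_zero), FormalMultilinearSeries.compContinuousLinearMap_apply]
  have e : (⇑(-ContinuousLinearMap.id ℂ ℂ) ∘ fun _ : Fin n => -x) = fun _ => x := by
    funext i
    simp
  rw [e, ordinaryHypergeometricSeries_apply_eq, smul_eq_mul, neg_neg,
    ← ordinaryHypergeometricCoefficient_eq]
  simp [ordinaryHypergeometricCoefficient]

theorem summable_norm_hypCoeff_one_mul_pow (a : ℝ) {r : ℝ} (h0 : 0 ≤ r) (hr : r < 1) :
    Summable fun n => |hypCoeff a 1 1 n| * r ^ n := by
  have h := (hasSum_one_sub_cpow_neg a (x := (r : ℂ))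
    (by rwa [Complex.norm_real, Real.norm_of_nonneg h0])).summable.norm
  refine h.congr fun n => ?_
  simp [abs_of_nonneg h0]

/-- `hypCoeff a 1 1 n` is the binomial coefficient (a)ₙ/n!, and inserting tⁿ multiplies the beta
integral by (b)ₙ/(b+d)ₙ. Integrating the binomial series term by term thus gives the hypergeometric
series. -/
theorem betaIntegral_add_nat {b d : ℝ} (hb : 0 < b) (hd : 0 < d) (a : ℝ) (n : ℕ) :
    (hypCoeff a 1 1 n : ℂ) * Complex.betaIntegral (b + n : ℝ) d =
      hypCoeff a b (b + d) n * Complex.betaIntegral b d := by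
  have hG (n : ℕ) : Complex.betaIntegral (b + n : ℝ) d =
      Complex.Gamma (b + n) * Complex.Gamma d / Complex.Gamma (b + d + n) := by
    rw [Complex.betaIntegral_eq_Gamma_mul_div _ _ (by simp; positivity) (by simpa)]
    push_cast
    congr 2
    ring
  have hb' (n : ℕ) : (b + n : ℂ) ≠ 0 := by exact_mod_cast (by positivity : (b + n : ℝ) ≠ 0)
  have hd' (n : ℕ) : (b + d + n : ℂ) ≠ 0 := by exact_mod_cast (by positivity : (b + d + n : ℝ) ≠ 0)
  induction n with
  | zero => simp [hypCoeff]
  | succ n ih =>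
    have hn : (n + 1 : ℂ) ≠ 0 := by exact_mod_cast n.succ_ne_zero
    have hn' : (1 + n : ℂ) ≠ 0 := by rwa [add_comm]
    have hΓ : Complex.Gamma (b + d + n) ≠ 0 :=
      Complex.Gamma_ne_zero_of_re_pos (by simp; positivity)
    have e : Complex.betaIntegral (b + (n + 1 : ℕ) : ℝ) d =
        Complex.betaIntegral (b + n : ℝ) d * ((b + n) / (b + d + n)) := by
      rw [hG, hG]
      push_cast
      rw [← add_assoc, ← add_assoc, Complex.Gamma_add_one _ (hb' n), Complex.Gamma_add_one _ (hd' n)]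
      have := hd' n
      field_simp
    rw [e, hypCoeff, hypCoeff]
    push_cast
    have := hd' n
    calc _ = ((hypCoeff a 1 1 n : ℂ) * Complex.betaIntegral (b + n : ℝ) d) *
          (((a + n) * (1 + n) / ((n + 1) * (1 + n))) * ((b + n) / (b + d + n))) := by
          push_cast; ring
      _ = _ := by
          rw [ih]
          field_simp

theorem eulerIntegral_eq_ordinaryHypergeometric (a : ℝ) {b d : ℝ} (hb : 0 < b) (hd : 0 < d) {s : ℂ}
    (hs : ‖s‖ < 1) :
    eulerIntegral a b d s = ordinaryHypergeometric (a : ℂ) b (b + d : ℝ) s := by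
  rw [ordinaryHypergeometric_eq]
  have hmoment (n : ℕ) : ∫ t in Ioo (0 : ℝ) 1, (betaWeight b d t : ℂ) * ((hypCoeff a 1 1 n : ℂ) *
      (t * s) ^ n) = Complex.betaIntegral b d * (hypCoeff a b (b + d) n * s ^ n) := by
    have : ∀ t ∈ Ioo (0 : ℝ) 1, (betaWeight b d t : ℂ) * ((hypCoeff a 1 1 n : ℂ) * (t * s) ^ n) =
        ((hypCoeff a 1 1 n : ℂ) * s ^ n) * (betaWeight (b + n) d t : ℂ) := by
      intro t ht
      have e : betaWeight (b + n) d t = betaWeight b d t * t ^ n := by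
        rw [betaWeight, betaWeight, show b + n - 1 = b - 1 + n by ring,
          Real.rpow_add ht.1, Real.rpow_natCast]
        ring
      rw [e]
      push_cast
      ring
    rw [setIntegral_congr_fun measurableSet_Ioo this, integral_const_mul, integral_ofReal_betaWeight]
    linear_combination s ^ n * betaIntegral_add_nat hb hd a n
  have hbound (n : ℕ) : ∀ᵐ t : ℝ ∂volume.restrict (Ioo 0 1),
      ‖(betaWeight b d t : ℂ) * ((hypCoeff a 1 1 n : ℂ) * (t * s) ^ n)‖ ≤
        betaWeight b d t * (|hypCoeff a 1 1 n| * ‖s‖ ^ n) := by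
    refine (ae_restrict_iff' measurableSet_Ioo).2 (Eventually.of_forall fun t ht => ?_)
    have hw := (betaWeight_pos b d ht).le
    have hts : ‖(t * s : ℂ)‖ ≤ ‖s‖ := by
      rw [norm_mul, Complex.norm_real, Real.norm_of_nonneg ht.1.le]
      exact mul_le_of_le_one_left (norm_nonneg s) ht.2.le
    rw [norm_mul, norm_mul, norm_pow, Complex.norm_real, Complex.norm_real,
      Real.norm_of_nonneg hw, Real.norm_eq_abs]
    gcongr
  have hint (n : ℕ) : IntegrableOn (fun t : ℝ => (betaWeight b d t : ℂ) * ((hypCoeff a 1 1 n : ℂ) *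
      (t * s) ^ n)) (Ioo 0 1) := by
    refine Integrable.mono' ((integrableOn_betaWeight hb hd).mul_const
      (|hypCoeff a 1 1 n| * ‖s‖ ^ n)) ?_ ?_
    · exact ((integrableOn_betaWeight hb hd).ofReal (𝕜 := ℂ)).aestronglyMeasurable.mul
        (Continuous.aestronglyMeasurable (by fun_prop))
    · exact hbound n
  have hnorm : Summable fun n => ∫ t in Ioo (0 : ℝ) 1,
      ‖(betaWeight b d t : ℂ) * ((hypCoeff a 1 1 n : ℂ) * (t * s) ^ n)‖ := by
    refine Summable.of_nonneg_of_le (fun n => integral_nonneg fun t => norm_nonneg _) (fun n => ?_)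
      ((summable_norm_hypCoeff_one_mul_pow a (norm_nonneg s) hs).mul_left
        (∫ t in Ioo (0 : ℝ) 1, betaWeight b d t))
    rw [← integral_mul_const]
    exact integral_mono_ae (hint n).norm ((integrableOn_betaWeight hb hd).mul_const _) (hbound n)
  have hsum := hasSum_integral_of_summable_integral_norm (μ := volume.restrict (Ioo (0 : ℝ) 1))
    (F := fun n t => (betaWeight b d t : ℂ) * ((hypCoeff a 1 1 n : ℂ) * (t * s) ^ n)) hint hnorm
  simp_rw [hmoment] at hsum
  have htsum : ∫ t in Ioo (0 : ℝ) 1, ∑' n, (betaWeight b d t : ℂ) * ((hypCoeff a 1 1 n : ℂ) *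
      (t * s) ^ n) = ∫ t in Ioo (0 : ℝ) 1, (betaWeight b d t : ℂ) * (1 - t * s) ^ (-a : ℂ) := by
    refine setIntegral_congr_fun measurableSet_Ioo fun t ht => ?_
    rw [tsum_mul_left, (hasSum_one_sub_cpow_neg a _).tsum_eq]
    rw [norm_mul, Complex.norm_real, Real.norm_of_nonneg ht.1.le]
    exact (mul_le_of_le_one_left (norm_nonneg s) ht.2.le).trans_lt hs
  rw [htsum] at hsum
  rw [eulerIntegral, ← hsum.tsum_eq, tsum_mul_left,
    inv_mul_cancel_left₀ (betaIntegral_ne_zero hb hd)]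

theorem summable_mul_pow_of_norm_le {u : ℕ → ℂ} {C : ℝ} {k : ℕ}
    (hu : ∀ n, ‖u n‖ ≤ C * (n : ℝ) ^ k) {s : ℂ} (hs : ‖s‖ < 1) :
    Summable fun n => u n * s ^ n := by
  refine Summable.of_norm_bounded ((summable_pow_mul_geometric_of_norm_lt_one k
    (r := ‖s‖) (by simpa using hs)).mul_left C) fun n => ?_
  rw [norm_mul, norm_pow, ← mul_assoc]
  gcongr
  exact hu n

theorem hasDerivAt_tsum_mul_pow {u : ℕ → ℂ} {C : ℝ} {k : ℕ}
    (hu : ∀ n, ‖u n‖ ≤ C * (n : ℝ) ^ k) {s : ℂ} (hs : ‖s‖ < 1) :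
    HasDerivAt (fun s => ∑' n, u n * s ^ n) (∑' n, (n + 1) * u (n + 1) * s ^ n) s := by
  obtain ⟨r, hsr, hr⟩ := exists_between hs
  have hr0 : 0 ≤ r := (norm_nonneg s).trans hsr.le
  have hsum : Summable fun n : ℕ => (n : ℝ) * (C * (n : ℝ) ^ k) * r ^ (n - 1) := by
    rw [← summable_nat_add_iff 1]
    have h := (summable_nat_add_iff 1).2 (summable_pow_mul_geometric_of_norm_lt_one (k + 1)
      (r := r) (by rwa [Real.norm_of_nonneg hr0]))
    rcases hr0.eq_or_lt with rfl | hr0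
    · refine summable_of_ne_finset_zero (s := {0}) fun n hn => ?_
      simp at hn
      simp [hn]
    · refine (h.mul_left (C * r⁻¹)).congr fun n => ?_
      simp only [Nat.add_sub_cancel]
      field_simp
      ring
  have key := hasDerivAt_tsum_of_isPreconnected (g := fun n (y : ℂ) => u n * y ^ n)
    (g' := fun n y => u n * (n * y ^ (n - 1))) hsum Metric.isOpen_ball
    (convex_ball (0 : ℂ) r).isPreconnected
    (fun n y _ => (hasDerivAt_pow n y).const_mul (u n)) (fun n y hy => by
      rw [mem_ball_zero_iff] at hy
      rw [norm_mul, norm_mul, norm_pow, Complex.norm_natCast, ← mul_assoc, mul_comm ‖u n‖]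
      exact mul_le_mul (mul_le_mul_of_nonneg_left (hu n) (Nat.cast_nonneg n))
        (pow_le_pow_left₀ (norm_nonneg y) hy.le _) (by positivity)
        (mul_nonneg (Nat.cast_nonneg n) ((norm_nonneg _).trans (hu n)))) (mem_ball_zero_iff.2 hsr) (summable_mul_pow_of_norm_le hu hs)
    (mem_ball_zero_iff.2 hsr)
  convert! key using 1
  have hsum' : Summable fun n : ℕ => u n * (n * s ^ (n - 1)) := by
    refine Summable.of_norm_bounded hsum fun n => ?_
    rw [norm_mul, norm_mul, norm_pow, Complex.norm_natCast, ← mul_assoc, mul_comm ‖u n‖]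
    exact mul_le_mul (mul_le_mul_of_nonneg_left (hu n) (Nat.cast_nonneg n))
      (pow_le_pow_left₀ (norm_nonneg s) hsr.le _) (by positivity)
      (mul_nonneg (Nat.cast_nonneg n) ((norm_nonneg _).trans (hu n)))
  rw [hsum'.tsum_eq_zero_add]
  simp only [Nat.cast_zero, zero_mul, mul_zero, zero_add, Nat.add_sub_cancel]
  refine tsum_congr fun n => ?_
  push_cast
  ring

theorem mul_tsum_succ_mul_pow {u : ℕ → ℂ} {C : ℝ} {k : ℕ}
    (hu : ∀ n, ‖u n‖ ≤ C * (n : ℝ) ^ k) {s : ℂ} (hs : ‖s‖ < 1) :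
    s * ∑' n, (n + 1) * u (n + 1) * s ^ n = ∑' n, (n * u n) * s ^ n := by
  have hu' : ∀ n : ℕ, ‖(n : ℂ) * u n‖ ≤ C * (n : ℝ) ^ (k + 1) := fun n => by
    rw [norm_mul, Complex.norm_natCast, pow_succ, ← mul_assoc, mul_comm]
    exact mul_le_mul_of_nonneg_right (hu n) (Nat.cast_nonneg n)
  rw [(summable_mul_pow_of_norm_le hu' hs).tsum_eq_zero_add, ← tsum_mul_left]
  simp only [Nat.cast_zero, zero_mul, zero_add]
  refine tsum_congr fun n => ?_
  push_cast
  ring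

theorem isPreconnected_slitOne : IsPreconnected slitOne := by
  have h : slitOne = (fun z : ℂ => 1 - z) '' Complex.slitPlane := by
    ext s
    constructor
    · exact fun hs => ⟨1 - s, hs, by simp⟩
    · rintro ⟨z, hz, rfl⟩
      simpa [slitOne] using hz
  rw [h]
  exact (Complex.starConvex_one_slitPlane.isPathConnected
    Complex.one_mem_slitPlane).isConnected.isPreconnected.image _ (by fun_prop)

/-- The hypergeometric differential equation. -/
theorem hypergeometric_ode {a b c : ℝ} (ha0 : 0 ≤ a) (ha : a ≤ 1) (hb0 : 0 ≤ b) (hb : b ≤ c)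
    (hc : 0 < c) {F : ℂ → ℂ} (hF : DifferentiableOn ℂ F slitOne)
    (hser : ∀ s : ℂ, ‖s‖ < 1 → F s = ∑' n, (hypCoeff a b c n : ℂ) * s ^ n) {s : ℂ}
    (hs : s ∈ slitOne) :
    s * (1 - s) * deriv (deriv F) s + (c - (a + b + 1) * s) * deriv F s - a * b * F s = 0 := by
  have hF1 : DifferentiableOn ℂ (deriv F) slitOne := hF.deriv isOpen_slitOne
  have hF2 : DifferentiableOn ℂ (deriv (deriv F)) slitOne := hF1.deriv isOpen_slitOne
  have hdiff : DifferentiableOn ℂ (fun s => s * (1 - s) * deriv (deriv F) s +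
      (c - (a + b + 1) * s) * deriv F s - a * b * F s) slitOne := by
    fun_prop
  set h : ℕ → ℂ := fun n => (hypCoeff a b c n : ℂ) with hh
  have hbd0 (n : ℕ) : ‖h n‖ ≤ 1 * (n : ℝ) ^ 0 := by
    have := hypCoeff_mem_Icc ha0 ha hb0 hb hc n
    simp only [hh, Complex.norm_real, Real.norm_of_nonneg this.1]
    simpa using this.2
  have hbd1 (n : ℕ) : ‖(n : ℂ) * h n‖ ≤ 1 * (n : ℝ) ^ 1 := by
    rw [norm_mul, Complex.norm_natCast]
    have := hbd0 n
    simp at this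
    nlinarith [(Nat.cast_nonneg n : (0 : ℝ) ≤ n)]
  have hbd2 (n : ℕ) : ‖(n : ℂ) * (n * h n)‖ ≤ 1 * (n : ℝ) ^ 2 := by
    rw [norm_mul, Complex.norm_natCast]
    have := hbd1 n
    nlinarith [(Nat.cast_nonneg n : (0 : ℝ) ≤ n)]
  have hd1 (w : ℂ) (hw : ‖w‖ < 1) : w * deriv F w = ∑' n, (n * h n) * w ^ n := by
    have e : F =ᶠ[𝓝 w] fun s => ∑' n, h n * s ^ n := by
      filter_upwards [Metric.isOpen_ball.mem_nhds (mem_ball_zero_iff.2 hw)] with z hz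
      exact hser z (mem_ball_zero_iff.1 hz)
    rw [e.deriv_eq, (hasDerivAt_tsum_mul_pow hbd0 hw).deriv, mul_tsum_succ_mul_pow hbd0 hw]
  have hd2 (w : ℂ) (hw : ‖w‖ < 1) : w * (deriv F w + w * deriv (deriv F) w) =
      ∑' n, (n * (n * h n)) * w ^ n := by
    have e : (fun w => w * deriv F w) =ᶠ[𝓝 w] fun s => ∑' n, (n * h n) * s ^ n := by
      filter_upwards [Metric.isOpen_ball.mem_nhds (mem_ball_zero_iff.2 hw)] with z hz
      exact hd1 z (mem_ball_zero_iff.1 hz)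
    have hdw := hF1.differentiableAt (isOpen_slitOne.mem_nhds (mem_slitOne_of_norm_lt_one hw))
    have := e.deriv_eq
    rw [((hasDerivAt_id' w).fun_mul hdw.hasDerivAt).deriv, (hasDerivAt_tsum_mul_pow hbd1 hw).deriv] at this
    rw [← mul_tsum_succ_mul_pow hbd1 hw, ← this]
    simp
  -- With θ = w d/dw this is θ(θ + c - 1)F = w(θ + a)(θ + b)F, checked on coefficients.
  have hrec (w : ℂ) (hw : ‖w‖ < 1) :
      ∑' n, (n * (n * h n)) * w ^ n + (c - 1) * ∑' n, (n * h n) * w ^ n =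
      w * (∑' n, (n * (n * h n)) * w ^ n + (a + b) * ∑' n, (n * h n) * w ^ n +
        a * b * ∑' n, h n * w ^ n) := by
    have s0 := summable_mul_pow_of_norm_le hbd0 hw
    have s1 := summable_mul_pow_of_norm_le hbd1 hw
    have s2 := summable_mul_pow_of_norm_le hbd2 hw
    have sL : Summable fun n : ℕ => (n * (n * h n)) * w ^ n + (c - 1) * ((n * h n) * w ^ n) :=
      s2.add (s1.mul_left _)
    rw [← tsum_mul_left, ← tsum_mul_left, ← tsum_mul_left, ← s2.tsum_add (s1.mul_left _),
      ← s2.tsum_add (s1.mul_left _), ← (s2.add (s1.mul_left _)).tsum_add (s0.mul_left _),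
      ← tsum_mul_left, sL.tsum_eq_zero_add]
    simp only [Nat.cast_zero, zero_mul, mul_zero, zero_add]
    refine tsum_congr fun n => ?_
    have hn : (n + 1 : ℂ) ≠ 0 := by exact_mod_cast n.succ_ne_zero
    have hcn : (c + n : ℂ) ≠ 0 := by exact_mod_cast (by positivity : (c + n : ℝ) ≠ 0)
    have hr : h (n + 1) = h n * ((a + n) * (b + n) / ((n + 1) * (c + n))) := by
      simp only [hh, hypCoeff]
      push_cast
      rfl
    rw [hr]
    push_cast
    field_simp
    ring
  -- The θ-form is w times the equation, so it is divided by w near 1/2, away from 0; the identity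
  -- theorem does the rest.
  have hev : (fun s => s * (1 - s) * deriv (deriv F) s +
      (c - (a + b + 1) * s) * deriv F s - a * b * F s) =ᶠ[𝓝 (1 / 2 : ℂ)] fun _ => 0 := by
    have h1 : ∀ᶠ w in 𝓝 (1 / 2 : ℂ), w ∈ Metric.ball (0 : ℂ) 1 :=
      Metric.isOpen_ball.mem_nhds (by rw [mem_ball_zero_iff]; norm_num)
    have h2 : ∀ᶠ w in 𝓝 (1 / 2 : ℂ), w ≠ 0 := isOpen_ne.mem_nhds (by norm_num)
    filter_upwards [h1, h2] with w hw hw0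
    rw [mem_ball_zero_iff] at hw
    have e := hrec w hw
    rw [← hd1 w hw, ← hd2 w hw, ← hser w hw] at e
    apply mul_left_cancel₀ hw0
    linear_combination e
  exact (hdiff.analyticOnNhd isOpen_slitOne).eqOn_of_preconnected_of_eventuallyEq
    (analyticOnNhd_const (v := (0 : ℂ))) isPreconnected_slitOne
    (mem_slitOne_of_norm_lt_one (by norm_num)) hev hs

/-! ### Growth at the singular point s = 1. -/

/-- Multiplying by 1 - x replaces uₙ by uₙ - uₙ₋₁, whose series telescopes to l; Abel's limit
theorem applies. -/
theorem tendsto_one_sub_mul_tsum {u : ℕ → ℂ} {l : ℂ} (hu : Tendsto u atTop (𝓝 l)) :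
    Tendsto (fun x : ℝ => (1 - (x : ℂ)) * ∑' n, u n * (x : ℂ) ^ n) (𝓝[<] 1) (𝓝 l) := by
  set f : ℕ → ℂ := fun n => u n - if n = 0 then 0 else u (n - 1) with hf
  have hpart (n : ℕ) : ∑ i ∈ Finset.range (n + 1), f i = u n := by
    induction n with
    | zero => simp [hf]
    | succ n ih =>
      rw [Finset.sum_range_succ, ih]
      simp [hf]
  have hlim : Tendsto (fun n => ∑ i ∈ Finset.range n, f i) atTop (𝓝 l) := by
    rw [← tendsto_add_atTop_iff_nat 1]
    simpa only [hpart] using hu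
  have habel := Complex.tendsto_tsum_powerSeries_nhdsWithin_lt hlim
  rw [tendsto_map'_iff] at habel
  refine habel.congr' ?_
  obtain ⟨C, hC⟩ := (Metric.isBounded_range_of_tendsto u hu).exists_norm_le
  filter_upwards [Ioo_mem_nhdsLT (zero_lt_one (α := ℝ))] with x hx
  have hx1 : ‖(x : ℂ)‖ < 1 := by
    rw [Complex.norm_real, Real.norm_of_nonneg hx.1.le]
    exact hx.2
  have hs : Summable fun n => u n * (x : ℂ) ^ n :=
    summable_mul_pow_of_norm_le (C := C) (k := 0) (fun n => by
      simpa using hC _ (mem_range_self n)) hx1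
  have hs' : Summable fun n => (if n = 0 then 0 else u (n - 1)) * (x : ℂ) ^ n := by
    rw [← summable_nat_add_iff 1]
    refine (hs.mul_left (x : ℂ)).congr fun n => ?_
    simp [pow_succ]
    ring
  simp only [Function.comp, hf, sub_mul]
  rw [hs.tsum_sub hs', hs'.tsum_eq_zero_add, one_mul, ← tsum_mul_left]
  congr 1
  simp only [if_true, zero_mul, zero_add]
  refine tsum_congr fun n => ?_
  simp [pow_succ]
  ring

/-- The n-th term is exactly the quotient of Euler's approximants to Γ(a+b), Γ(a) and Γ(b): the
powers of n cancel. -/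
theorem tendsto_succ_mul_hypCoeff {a b : ℝ} (ha : 0 < a) (hb : 0 < b) :
    Tendsto (fun n : ℕ => (n + 1) * hypCoeff a b (a + b) (n + 1)) atTop
      (𝓝 (Real.Gamma (a + b) / (Real.Gamma a * Real.Gamma b))) := by
  have hlim := (Real.GammaSeq_tendsto_Gamma (a + b)).div
    ((Real.GammaSeq_tendsto_Gamma a).mul (Real.GammaSeq_tendsto_Gamma b))
    (mul_ne_zero (Real.Gamma_pos_of_pos ha).ne' (Real.Gamma_pos_of_pos hb).ne')
  refine hlim.congr' ?_
  have hprod (n : ℕ) : n.factorial * hypCoeff a b (a + b) n * ∏ j ∈ Finset.range n, (a + b + j) =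
      (∏ j ∈ Finset.range n, (a + j)) * ∏ j ∈ Finset.range n, (b + j) := by
    induction n with
    | zero => simp [hypCoeff]
    | succ n ih =>
      rw [Finset.prod_range_succ, Finset.prod_range_succ, Finset.prod_range_succ, hypCoeff,
        Nat.factorial_succ]
      have h1 : (n + 1 : ℝ) ≠ 0 := by positivity
      have h2 : (a + b + n : ℝ) ≠ 0 := by positivity
      push_cast
      field_simp
      linear_combination ih
  filter_upwards [eventually_gt_atTop 0] with n hn
  have hn0 : (0 : ℝ) < n := Nat.cast_pos.2 hn
  have h := hprod (n + 1)
  have pa : 0 < ∏ j ∈ Finset.range (n + 1), (a + j) := Finset.prod_pos fun j _ => by positivity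
  have pb : 0 < ∏ j ∈ Finset.range (n + 1), (b + j) := Finset.prod_pos fun j _ => by positivity
  have pab : 0 < ∏ j ∈ Finset.range (n + 1), (a + b + j) := Finset.prod_pos fun j _ => by positivity
  rw [Nat.factorial_succ] at h
  push_cast at h
  have hf : (0 : ℝ) < n.factorial := Nat.cast_pos.2 n.factorial_pos
  simp only [Pi.div_apply, Real.GammaSeq, Real.rpow_add hn0]
  have hna := Real.rpow_pos_of_pos hn0 a
  have hnb := Real.rpow_pos_of_pos hn0 b
  field_simp
  linear_combination -h

/-! ### The branches χ₁ and φ, and the cut plane. -/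

/-- The principal branch of `₂F₁(1/6, 1/2; 1; ·)`. -/
noncomputable def chi : ℂ → ℂ := eulerIntegral (1 / 6) (1 / 2) (1 / 2)

/-- The principal branch of `₂F₁(1/6, 1/2; 2/3; ·)`. -/
noncomputable def phi : ℂ → ℂ := eulerIntegral (1 / 6) (1 / 2) (1 / 6)

theorem differentiableOn_chi : DifferentiableOn ℂ chi slitOne :=
  differentiableOn_eulerIntegral _ (by norm_num) (by norm_num)

theorem differentiableOn_phi : DifferentiableOn ℂ phi slitOne :=
  differentiableOn_eulerIntegral _ (by norm_num) (by norm_num)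

theorem isHypergeometricBranch_chi : IsHypergeometricBranch (1 / 6) (1 / 2) 1 chi where
  analytic := differentiableOn_chi.analyticOnNhd isOpen_slitOne
  eq_series s hs := by
    rw [chi, eulerIntegral_eq_ordinaryHypergeometric _ (by norm_num) (by norm_num) hs]
    norm_num

theorem isHypergeometricBranch_phi : IsHypergeometricBranch (1 / 6) (1 / 2) (2 / 3) phi where
  analytic := differentiableOn_phi.analyticOnNhd isOpen_slitOne
  eq_series s hs := by
    rw [phi, eulerIntegral_eq_ordinaryHypergeometric _ (by norm_num) (by norm_num) hs]
    norm_num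

theorem chi_eq_tsum {s : ℂ} (hs : ‖s‖ < 1) :
    chi s = ∑' n, (hypCoeff (1 / 6) (1 / 2) 1 n : ℂ) * s ^ n := by
  rw [chi, eulerIntegral_eq_ordinaryHypergeometric _ (by norm_num) (by norm_num) hs,
    ordinaryHypergeometric_eq]
  norm_num

theorem phi_eq_tsum {s : ℂ} (hs : ‖s‖ < 1) :
    phi s = ∑' n, (hypCoeff (1 / 6) (1 / 2) (2 / 3) n : ℂ) * s ^ n := by
  rw [phi, eulerIntegral_eq_ordinaryHypergeometric _ (by norm_num) (by norm_num) hs,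
    ordinaryHypergeometric_eq]
  norm_num

theorem chi_zero : chi 0 = 1 := by
  rw [isHypergeometricBranch_chi.eq_series 0 (by simp), ordinaryHypergeometric_zero]

theorem chi_ne_zero {s : ℂ} (hs : s ∈ slitOne) : chi s ≠ 0 := fun h => by
  have := eulerIntegral_re_pos (a := 1 / 6) (b := 1 / 2) (d := 1 / 2) (by norm_num) (by norm_num)
    (by norm_num) (by norm_num) hs
  rw [← chi, h] at this
  simp at this

theorem ofReal_tsum_mul_pow_im (u : ℕ → ℝ) (x : ℝ) :
    (∑' n, (u n : ℂ) * (x : ℂ) ^ n).im = 0 := by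
  have : ∑' n, (u n : ℂ) * (x : ℂ) ^ n = ((∑' n, u n * x ^ n : ℝ) : ℂ) := by
    rw [Complex.ofReal_tsum]
    push_cast
    rfl
  rw [this, Complex.ofReal_im]

theorem chi_ofReal_im {x : ℝ} (hx : x ∈ Ioo (0 : ℝ) 1) : (chi x).im = 0 := by
  rw [chi_eq_tsum (by rw [Complex.norm_real, Real.norm_of_nonneg hx.1.le]; exact hx.2)]
  exact ofReal_tsum_mul_pow_im _ x

theorem phi_ofReal_im {x : ℝ} (hx : x ∈ Ioo (0 : ℝ) 1) : (phi x).im = 0 := by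
  rw [phi_eq_tsum (by rw [Complex.norm_real, Real.norm_of_nonneg hx.1.le]; exact hx.2)]
  exact ofReal_tsum_mul_pow_im _ x

theorem chi_ode {s : ℂ} (hs : s ∈ slitOne) :
    s * (1 - s) * deriv (deriv chi) s + (1 - 5 / 3 * s) * deriv chi s - 1 / 12 * chi s = 0 := by
  have := hypergeometric_ode (a := 1 / 6) (b := 1 / 2) (c := 1) (by norm_num) (by norm_num)
    (by norm_num) (by norm_num) (by norm_num) differentiableOn_chi (fun _ h => chi_eq_tsum h) hs
  norm_num at this
  linear_combination this

theorem phi_ode {s : ℂ} (hs : s ∈ slitOne) :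
    s * (1 - s) * deriv (deriv phi) s + (2 / 3 - 5 / 3 * s) * deriv phi s - 1 / 12 * phi s = 0 := by
  have := hypergeometric_ode (a := 1 / 6) (b := 1 / 2) (c := 2 / 3) (by norm_num) (by norm_num)
    (by norm_num) (by norm_num) (by norm_num) differentiableOn_phi (fun _ h => phi_eq_tsum h) hs
  norm_num at this
  linear_combination this

theorem isOpen_cutPlane : IsOpen cutPlane := Complex.isOpen_slitPlane.inter isOpen_slitOne

theorem mem_slitOne_of_mem_cutPlane {s : ℂ} (hs : s ∈ cutPlane) : s ∈ slitOne := hs.2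

theorem one_sub_mem_slitOne {s : ℂ} (hs : s ∈ cutPlane) : 1 - s ∈ slitOne := by
  change 1 - (1 - s) ∈ Complex.slitPlane
  rw [sub_sub_cancel]
  exact hs.1

theorem starConvex_cutPlane : StarConvex ℝ (1 / 2 : ℂ) cutPlane := by
  have h := Complex.starConvex_ofReal_slitPlane (x := 1 / 2) (by norm_num)
  push_cast at h
  intro s hs a b ha hb hab
  refine ⟨h hs.1 ha hb hab, ?_⟩
  have := h hs.2 ha hb hab
  convert this using 1
  have hab' : (a : ℂ) + b = 1 := by exact_mod_cast hab
  simp only [Complex.real_smul]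
  linear_combination -hab'

theorem ofReal_mem_cutPlane {x : ℝ} (hx : x ∈ Ioo (0 : ℝ) 1) : (x : ℂ) ∈ cutPlane := by
  refine ⟨Complex.ofReal_mem_slitPlane.2 hx.1, ?_⟩
  have := Complex.ofReal_mem_slitPlane.2 (sub_pos.2 hx.2)
  push_cast at this
  exact this

theorem isPreconnected_cutPlane : IsPreconnected cutPlane := by
  have h : ((1 / 2 : ℝ) : ℂ) ∈ cutPlane := ofReal_mem_cutPlane (by constructor <;> norm_num)
  push_cast at h
  exact (starConvex_cutPlane.isPathConnected h).isConnected.isPreconnected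

theorem ne_zero_of_mem_cutPlane {s : ℂ} (hs : s ∈ cutPlane) : s ≠ 0 :=
  Complex.slitPlane_ne_zero hs.1

theorem one_sub_ne_zero_of_mem_slitOne {s : ℂ} (hs : s ∈ slitOne) : 1 - s ≠ 0 :=
  Complex.slitPlane_ne_zero hs

theorem hasDerivAt_one_sub_cpow (r : ℂ) {s : ℂ} (hs : s ∈ slitOne) :
    HasDerivAt (fun s : ℂ => (1 - s) ^ r) (-(r * (1 - s) ^ r / (1 - s))) s := by
  have h := ((hasDerivAt_id' s).const_sub 1).cpow_const (c := r) hs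
  convert h using 1
  rw [Complex.cpow_sub _ _ (one_sub_ne_zero_of_mem_slitOne hs), Complex.cpow_one]
  ring

theorem hasDerivAt_chi {s : ℂ} (hs : s ∈ slitOne) : HasDerivAt chi (deriv chi s) s :=
  (differentiableOn_chi.differentiableAt (isOpen_slitOne.mem_nhds hs)).hasDerivAt

theorem hasDerivAt_deriv_chi {s : ℂ} (hs : s ∈ slitOne) :
    HasDerivAt (deriv chi) (deriv (deriv chi) s) s :=
  ((differentiableOn_chi.deriv isOpen_slitOne).differentiableAt
    (isOpen_slitOne.mem_nhds hs)).hasDerivAt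

theorem hasDerivAt_phi {s : ℂ} (hs : s ∈ slitOne) : HasDerivAt phi (deriv phi s) s :=
  (differentiableOn_phi.differentiableAt (isOpen_slitOne.mem_nhds hs)).hasDerivAt

theorem hasDerivAt_deriv_phi {s : ℂ} (hs : s ∈ slitOne) :
    HasDerivAt (deriv phi) (deriv (deriv phi) s) s :=
  ((differentiableOn_phi.deriv isOpen_slitOne).differentiableAt
    (isOpen_slitOne.mem_nhds hs)).hasDerivAt

theorem HasDerivAt.comp_one_sub {f : ℂ → ℂ} {f' s : ℂ} (h : HasDerivAt f f' (1 - s)) :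
    HasDerivAt (fun s => f (1 - s)) (-f') s := by
  have := h.comp s ((hasDerivAt_id' s).const_sub 1)
  rw [mul_neg_one] at this
  exact this

/-! ### The Wronskian and the derivative of z. -/

/-- The Wronskian of `chi` and `phi (1 - ·)`, multiplied by the weight `s (1 - s)^{2/3}`. -/
noncomputable def weightedWronskian (s : ℂ) : ℂ :=
  s * (1 - s) ^ (2 / 3 : ℂ) * (chi s * -deriv phi (1 - s) - phi (1 - s) * deriv chi s)

/-- Abel's identity. Under s ↦ 1 - s the parameter c = 1 becomes a + b + 1 - c = 2/3, so φ(1 - s)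
solves the equation of χ₁, for which s(1-s)^{2/3} is the integrating factor. -/
theorem hasDerivAt_weightedWronskian {s : ℂ} (hs : s ∈ cutPlane) :
    HasDerivAt weightedWronskian 0 s := by
  have hs1 := mem_slitOne_of_mem_cutPlane hs
  have hs2 := one_sub_mem_slitOne hs
  have h := ((hasDerivAt_id' s).mul (hasDerivAt_one_sub_cpow (2 / 3) hs1)).mul
    (((hasDerivAt_chi hs1).mul (hasDerivAt_deriv_phi hs2).comp_one_sub.neg).sub
      ((hasDerivAt_phi hs2).comp_one_sub.mul (hasDerivAt_deriv_chi hs1)))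
  convert! h using 1
  have h0 := ne_zero_of_mem_cutPlane hs
  have h1 := one_sub_ne_zero_of_mem_slitOne hs1
  have e1 := chi_ode hs1
  have e2 := phi_ode hs2
  simp only [Pi.mul_apply, Pi.sub_apply, Pi.neg_apply]
  field_simp
  linear_combination ((1 - s) ^ (2 / 3 : ℂ)) * (3 * phi (1 - s) * e1 - 3 * chi s * e2)

theorem norm_hypCoeff_phi_le (n : ℕ) :
    ‖(hypCoeff (1 / 6) (1 / 2) (2 / 3) n : ℂ)‖ ≤ 1 * (n : ℝ) ^ 0 := by
  have h := hypCoeff_mem_Icc (a := 1 / 6) (b := 1 / 2) (c := 2 / 3) (by norm_num) (by norm_num)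
    (by norm_num) (by norm_num) (by norm_num) n
  rw [Complex.norm_real, Real.norm_of_nonneg h.1]
  simpa using h.2

theorem deriv_phi_eq_tsum {s : ℂ} (hs : ‖s‖ < 1) :
    deriv phi s = ∑' n : ℕ, (n + 1) * (hypCoeff (1 / 6) (1 / 2) (2 / 3) (n + 1) : ℂ) * s ^ n := by
  have h := hasDerivAt_tsum_mul_pow norm_hypCoeff_phi_le hs
  rw [← h.deriv]
  refine EventuallyEq.deriv_eq ?_
  filter_upwards [Metric.isOpen_ball.mem_nhds (mem_ball_zero_iff.2 hs)] with w hw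
  exact phi_eq_tsum (mem_ball_zero_iff.1 hw)

theorem phi_zero : phi 0 = 1 := by
  rw [isHypergeometricBranch_phi.eq_series 0 (by simp), ordinaryHypergeometric_zero]

theorem eventually_norm_ofReal_lt_one : ∀ᶠ x : ℝ in 𝓝[<] 1, ‖(x : ℂ)‖ < 1 := by
  filter_upwards [Ioo_mem_nhdsLT (zero_lt_one (α := ℝ))] with x hx
  rw [Complex.norm_real, Real.norm_of_nonneg hx.1.le]
  exact hx.2

theorem tendsto_succ_mul_hypCoeff_phi :
    Tendsto (fun n : ℕ => (n + 1) * (hypCoeff (1 / 6) (1 / 2) (2 / 3) (n + 1) : ℂ)) atTop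
      (𝓝 ((Real.Gamma (2 / 3) / (Real.Gamma (1 / 6) * Real.Gamma (1 / 2)) : ℝ) : ℂ)) := by
  have h := tendsto_succ_mul_hypCoeff (a := 1 / 6) (b := 1 / 2) (by norm_num) (by norm_num)
  norm_num only at h
  have := (Complex.continuous_ofReal.tendsto _).comp h
  norm_num only
  refine this.congr fun n => ?_
  simp

theorem tendsto_one_sub_mul_deriv_phi :
    Tendsto (fun x : ℝ => (1 - (x : ℂ)) * deriv phi x) (𝓝[<] 1)
      (𝓝 ((Real.Gamma (2 / 3) / (Real.Gamma (1 / 6) * Real.Gamma (1 / 2)) : ℝ) : ℂ)) := by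
  refine (tendsto_one_sub_mul_tsum tendsto_succ_mul_hypCoeff_phi).congr' ?_
  filter_upwards [eventually_norm_ofReal_lt_one] with x hx
  rw [deriv_phi_eq_tsum hx]

theorem tendsto_one_sub_mul_phi :
    Tendsto (fun x : ℝ => (1 - (x : ℂ)) * phi x) (𝓝[<] 1) (𝓝 0) := by
  have h0 : Tendsto (fun n => (hypCoeff (1 / 6) (1 / 2) (2 / 3) n : ℂ)) atTop (𝓝 0) := by
    rw [← tendsto_add_atTop_iff_nat 1]
    have := tendsto_succ_mul_hypCoeff_phi.mul
      (tendsto_one_div_add_atTop_nhds_zero_nat (𝕜 := ℂ))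
    rw [mul_zero] at this
    refine this.congr fun n => ?_
    have : (n : ℂ) + 1 ≠ 0 := Nat.cast_add_one_ne_zero n
    field_simp
  refine (tendsto_one_sub_mul_tsum h0).congr' ?_
  filter_upwards [eventually_norm_ofReal_lt_one] with x hx
  rw [phi_eq_tsum hx]

theorem zero_mem_slitOne : (0 : ℂ) ∈ slitOne := mem_slitOne_of_norm_lt_one (by simp)

/-- The constant is evaluated along s = 1 - x with x → 1: (1-x)φ'(x) has the limit given by the
coefficient asymptotics, while (1-x)φ(x) → 0. -/
theorem weightedWronskian_eq {s : ℂ} (hs : s ∈ cutPlane) :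
    weightedWronskian s =
      -((Real.Gamma (2 / 3) / (Real.Gamma (1 / 6) * Real.Gamma (1 / 2)) : ℝ) : ℂ) := by
  set κ : ℂ := ((Real.Gamma (2 / 3) / (Real.Gamma (1 / 6) * Real.Gamma (1 / 2)) : ℝ) : ℂ)
  obtain ⟨c, hc⟩ := isOpen_cutPlane.exists_is_const_of_deriv_eq_zero isPreconnected_cutPlane
    (fun s hs => (hasDerivAt_weightedWronskian hs).differentiableAt.differentiableWithinAt)
    (fun s hs => (hasDerivAt_weightedWronskian hs).deriv)
  rw [hc s hs]
  have hsub : Tendsto (fun x : ℝ => 1 - (x : ℂ)) (𝓝[<] 1) (𝓝 0) := by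
    have : ContinuousAt (fun x : ℝ => 1 - (x : ℂ)) 1 := by fun_prop
    simpa using this.tendsto.mono_left nhdsWithin_le_nhds
  have hchi := (hasDerivAt_chi zero_mem_slitOne).continuousAt.tendsto.comp hsub
  have hchi' := (hasDerivAt_deriv_chi zero_mem_slitOne).continuousAt.tendsto.comp hsub
  have hpow : Tendsto (fun x : ℝ => (x : ℂ) ^ (2 / 3 : ℂ)) (𝓝[<] 1) (𝓝 1) := by
    have : ContinuousAt (fun x : ℝ => (x : ℂ) ^ (2 / 3 : ℂ)) 1 :=
      ContinuousAt.cpow Complex.continuous_ofReal.continuousAt continuousAt_const (by simp)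
    simpa using this.tendsto.mono_left nhdsWithin_le_nhds
  have hlim := hpow.mul ((hchi.mul tendsto_one_sub_mul_deriv_phi.neg).sub
    (tendsto_one_sub_mul_phi.mul hchi'))
  rw [chi_zero, zero_mul, one_mul, one_mul, sub_zero] at hlim
  refine tendsto_nhds_unique (tendsto_const_nhds.congr' ?_) hlim
  filter_upwards [Ioo_mem_nhdsLT (zero_lt_one (α := ℝ))] with x hx
  have hx' : (1 - (x : ℂ)) ∈ cutPlane := by
    have := ofReal_mem_cutPlane (x := 1 - x) ⟨by linarith [hx.2], by linarith [hx.1]⟩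
    push_cast at this
    exact this
  rw [← hc _ hx', weightedWronskian, sub_sub_cancel]
  simp only [Function.comp]
  ring

theorem constA_mul :
    constA * ((Real.Gamma (2 / 3) / (Real.Gamma (1 / 6) * Real.Gamma (1 / 2)) : ℝ) : ℂ) =
      Complex.I / Real.pi := by
  have h1 : (Real.Gamma (2 / 3) : ℂ) ≠ 0 :=
    Complex.ofReal_ne_zero.2 (Real.Gamma_pos_of_pos (by norm_num)).ne'
  have h2 : (Real.Gamma (1 / 6) : ℂ) ≠ 0 :=
    Complex.ofReal_ne_zero.2 (Real.Gamma_pos_of_pos (by norm_num)).ne'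
  have h3 : (Real.Gamma (1 / 2) : ℂ) ≠ 0 :=
    Complex.ofReal_ne_zero.2 (Real.Gamma_pos_of_pos (by norm_num)).ne'
  have e1 : Complex.Gamma (2 / 3) = Real.Gamma (2 / 3) := by rw [← Complex.Gamma_ofReal]; norm_num
  have e2 : Complex.Gamma (1 / 6) = Real.Gamma (1 / 6) := by rw [← Complex.Gamma_ofReal]; norm_num
  have e3 : Complex.Gamma (1 / 2) = Real.Gamma (1 / 2) := by rw [← Complex.Gamma_ofReal]; norm_num
  rw [constA, e1, e2, e3]
  push_cast
  field_simp

theorem zQuot_eq {s : ℂ} (hs : s ∈ slitOne) :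
    zQuot chi phi s = constA * phi (1 - s) / chi s + constB := by
  rw [zQuot, add_div, mul_div_cancel_right₀ _ (chi_ne_zero hs)]

theorem hasDerivAt_zQuot {s : ℂ} (hs : s ∈ cutPlane) :
    HasDerivAt (zQuot chi phi)
      (-(Complex.I / Real.pi) / (s * ((1 - s) ^ (2 / 3 : ℂ) * chi s ^ 2))) s := by
  have hs1 := mem_slitOne_of_mem_cutPlane hs
  have hs2 := one_sub_mem_slitOne hs
  have h := ((((hasDerivAt_phi hs2).comp_one_sub.const_mul constA).add
    ((hasDerivAt_chi hs1).const_mul constB)).div (hasDerivAt_chi hs1) (chi_ne_zero hs1))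
  convert! h using 1
  have h0 := ne_zero_of_mem_cutPlane hs
  have h1 := chi_ne_zero hs1
  have h2 : (1 - s) ^ (2 / 3 : ℂ) ≠ 0 := by
    rw [Complex.cpow_ne_zero_iff_of_exponent_ne_zero (by norm_num)]
    exact one_sub_ne_zero_of_mem_slitOne hs1
  have hW := weightedWronskian_eq hs
  rw [weightedWronskian] at hW
  rw [← constA_mul, div_eq_div_iff (by positivity) (by positivity)]
  simp only [Pi.add_apply]
  linear_combination (-constA * chi s ^ 2) * hW

/-! ### The quotient z on (0,1) and its limit at s = 1. -/

/-- A is purely imaginary and χ₁, φ are real on (0,1), which leaves Re B = -cos(π/3). -/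
theorem re_zQuot {x : ℝ} (hx : x ∈ Ioo (0 : ℝ) 1) : (zQuot chi phi x).re = -1 / 2 := by
  have e1 : Complex.Gamma (2 / 3) = Real.Gamma (2 / 3) := by rw [← Complex.Gamma_ofReal]; norm_num
  have e2 : Complex.Gamma (1 / 6) = Real.Gamma (1 / 6) := by rw [← Complex.Gamma_ofReal]; norm_num
  have e3 : Complex.Gamma (1 / 2) = Real.Gamma (1 / 2) := by rw [← Complex.Gamma_ofReal]; norm_num
  rw [zQuot_eq (mem_slitOne_of_mem_cutPlane (ofReal_mem_cutPlane hx)), constA, constB, e1, e2, e3]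
  have hc : chi x = ((chi x).re : ℂ) := Complex.ext (by simp) (by simp [chi_ofReal_im hx])
  have hp : phi (1 - x) = ((phi (1 - x)).re : ℂ) := by
    have := phi_ofReal_im (x := 1 - x) ⟨by linarith [hx.2], by linarith [hx.1]⟩
    push_cast at this
    exact Complex.ext (by simp) (by simp [this])
  rw [hc, hp]
  have : (Real.pi : ℂ) * Complex.I / 3 = ((Real.pi / 3 : ℝ) : ℂ) * Complex.I := by
    push_cast; ring
  rw [this, Complex.add_re, Complex.neg_re, Complex.exp_ofReal_mul_I_re, Real.cos_pi_div_three]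
  have : ∀ (a b c d e f : ℝ), (Complex.I / (a : ℂ) * ((b : ℂ) * c / d) * e / f).re = 0 := by
    intro a b c d e f
    have : Complex.I / (a : ℂ) * ((b : ℂ) * c / d) * e / f =
      ((b * c / d * e / f / a : ℝ) : ℂ) * Complex.I := by push_cast; ring
    rw [this, Complex.re_ofReal_mul, Complex.I_re, mul_zero]
  rw [this]
  norm_num

/-- The denominator is the limit of χ₁ at 1. Written in Gamma values, the quotient collapses by the
reflection formula at 1/2, 1/6 and 1/3. -/
theorem constA_div_tendsto :
    constA / ((Complex.betaIntegral (1 / 2) (1 / 2))⁻¹ * Complex.betaIntegral (1 / 2) (1 / 3)) =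
      Real.sqrt 3 * Complex.I := by
  have g {r : ℂ} (hr : 0 < r.re) : Complex.Gamma r ≠ 0 := Complex.Gamma_ne_zero_of_re_pos hr
  have h16 := g (r := 1 / 6) (by norm_num)
  have h12 := g (r := 1 / 2) (by norm_num)
  have h13 := g (r := 1 / 3) (by norm_num)
  have h23 := g (r := 2 / 3) (by norm_num)
  have h56 := g (r := 5 / 6) (by norm_num)
  have hpi : (Real.pi : ℂ) ≠ 0 := Complex.ofReal_ne_zero.2 Real.pi_ne_zero
  have b1 := Complex.Gamma_mul_Gamma_eq_betaIntegral (s := 1 / 2) (t := 1 / 2)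
    (by norm_num) (by norm_num)
  have b2 := Complex.Gamma_mul_Gamma_eq_betaIntegral (s := 1 / 2) (t := 1 / 3)
    (by norm_num) (by norm_num)
  norm_num only [Complex.Gamma_one, one_mul] at b1 b2
  have r12 := Complex.Gamma_mul_Gamma_one_sub (1 / 2)
  have r16 := Complex.Gamma_mul_Gamma_one_sub (1 / 6)
  have r13 := Complex.Gamma_mul_Gamma_one_sub (1 / 3)
  have s12 : Complex.sin (Real.pi * (1 / 2)) = 1 := by
    rw [mul_one_div, Complex.sin_pi_div_two]
  have s16 : Complex.sin (Real.pi * (1 / 6)) = 1 / 2 := by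
    have : (Real.pi : ℂ) * (1 / 6) = ((Real.pi / 6 : ℝ) : ℂ) := by push_cast; ring
    rw [this, ← Complex.ofReal_sin, Real.sin_pi_div_six]; norm_num
  have s13 : Complex.sin (Real.pi * (1 / 3)) = Real.sqrt 3 / 2 := by
    have : (Real.pi : ℂ) * (1 / 3) = ((Real.pi / 3 : ℝ) : ℂ) := by push_cast; ring
    rw [this, ← Complex.ofReal_sin, Real.sin_pi_div_three]; norm_num
  rw [s12] at r12
  rw [s16] at r16
  rw [s13] at r13
  norm_num only at r12 r16 r13
  have h3 : ((Real.sqrt 3 : ℝ) : ℂ) ≠ 0 := Complex.ofReal_ne_zero.2 (by positivity)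
  have b2' : Complex.betaIntegral (1 / 2) (1 / 3) =
      Complex.Gamma (1 / 2) * Complex.Gamma (1 / 3) / Complex.Gamma (5 / 6) := by
    rw [eq_div_iff h56, b2]; ring
  rw [constA, b2', ← b1, r12]
  have e1 : Complex.Gamma (1 / 6) = Real.pi * 2 / Complex.Gamma (5 / 6) := by
    rw [eq_div_iff h56, r16]; ring
  have e2 : Complex.Gamma (1 / 3) = Real.pi * 2 / (Real.sqrt 3 * Complex.Gamma (2 / 3)) := by
    rw [eq_div_iff (by positivity)]
    rw [eq_div_iff (div_ne_zero h3 two_ne_zero)] at r13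
    linear_combination 2 * r13
  rw [e1, e2]
  field_simp

theorem omega_eq_sqrt_three : (omega : ℂ) = Real.sqrt 3 * Complex.I + constB := by
  have : (Real.pi : ℂ) * Complex.I / 3 = ((Real.pi / 3 : ℝ) : ℂ) * Complex.I := by
    push_cast; ring
  rw [constB, this]
  apply Complex.ext
  · rw [Complex.add_re, Complex.neg_re, Complex.exp_ofReal_mul_I_re]
    simp [omega]; norm_num
  · rw [Complex.add_im, Complex.neg_im, Complex.exp_ofReal_mul_I_im]
    simp [omega]; ring

theorem omega_eq_exp : (omega : ℂ) = Complex.exp (2 * Real.pi * Complex.I / 3) := by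
  have : 2 * (Real.pi : ℂ) * Complex.I / 3 = ((Real.pi - Real.pi / 3 : ℝ) : ℂ) * Complex.I := by
    push_cast; ring
  rw [this]
  apply Complex.ext
  · rw [Complex.exp_ofReal_mul_I_re, Real.cos_pi_sub]
    simp [omega]; norm_num
  · rw [Complex.exp_ofReal_mul_I_im, Real.sin_pi_sub]
    simp [omega]

theorem tendsto_zQuot_one :
    Tendsto (fun x : ℝ => zQuot chi phi x) (𝓝[<] 1) (𝓝 (omega : ℂ)) := by
  have hchi := tendsto_eulerIntegral_one (a := 1 / 6) (b := 1 / 2) (d := 1 / 2) (by norm_num)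
    (by norm_num) (by norm_num)
  have hne : (Complex.betaIntegral (1 / 2 : ℝ) (1 / 2 : ℝ))⁻¹ *
      Complex.betaIntegral (1 / 2 : ℝ) (1 / 2 - 1 / 6 : ℝ) ≠ 0 :=
    mul_ne_zero (inv_ne_zero (betaIntegral_ne_zero (by norm_num) (by norm_num)))
      (betaIntegral_ne_zero (by norm_num) (by norm_num))
  have hsub : Tendsto (fun x : ℝ => 1 - (x : ℂ)) (𝓝[<] 1) (𝓝 0) := by
    have : ContinuousAt (fun x : ℝ => 1 - (x : ℂ)) 1 := by fun_prop
    simpa using this.tendsto.mono_left nhdsWithin_le_nhds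
  have hphi := (hasDerivAt_phi zero_mem_slitOne).continuousAt.tendsto.comp hsub
  rw [phi_zero] at hphi
  have h := ((hphi.const_mul constA).div hchi hne).add_const constB
  have e := constA_div_tendsto
  norm_num at h e
  rw [omega_eq_sqrt_three, ← e]
  refine h.congr' ?_
  filter_upwards [Ioo_mem_nhdsLT (zero_lt_one (α := ℝ))] with x hx
  rw [zQuot_eq (mem_slitOne_of_mem_cutPlane (ofReal_mem_cutPlane hx)), chi]

/-! ### The quotient z and its nome near s = 0. -/

/-- The function `g` such that `s z'(s) = -(i / π) g(s)` for the quotient `z = zQuot chi phi`. -/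
noncomputable def zDensity (s : ℂ) : ℂ := ((1 - s) ^ (2 / 3 : ℂ) * chi s ^ 2)⁻¹

theorem one_sub_cpow_ne_zero (r : ℂ) {s : ℂ} (hs : s ∈ slitOne) : (1 - s) ^ r ≠ 0 := by
  rw [Ne, Complex.cpow_eq_zero_iff]
  exact fun h => one_sub_ne_zero_of_mem_slitOne hs h.1

theorem differentiableOn_zDensity : DifferentiableOn ℂ zDensity slitOne := fun _ hs =>
  DifferentiableAt.differentiableWithinAt <|
    ((hasDerivAt_one_sub_cpow (2 / 3) hs).differentiableAt.mul
      ((hasDerivAt_chi hs).differentiableAt.pow 2)).inv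
      (mul_ne_zero (one_sub_cpow_ne_zero _ hs) (pow_ne_zero 2 (chi_ne_zero hs)))

theorem zDensity_zero : zDensity 0 = 1 := by simp [zDensity, chi_zero]

theorem ball_subset_slitOne : Metric.ball (0 : ℂ) 1 ⊆ slitOne := fun _ hs =>
  mem_slitOne_of_norm_lt_one (mem_ball_zero_iff.1 hs)

/-- As `zDensity` equals 1 at 0, subtracting the logarithmic part of z' leaves a multiple of its
`dslope` at 0, which has a primitive G on the disc. The constant C stays undetermined here. -/
theorem exists_zQuot_eq_log : ∃ (G : ℂ → ℂ) (C : ℂ), G 0 = 0 ∧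
    (∀ s ∈ Metric.ball (0 : ℂ) 1, DifferentiableAt ℂ G s ∧ s * deriv G s = zDensity s - 1) ∧
    ∀ s ∈ cutPlane, ‖s‖ < 1 →
      zQuot chi phi s = -(Complex.I / Real.pi) * (Complex.log s + G s) + C := by
  have hd : DifferentiableOn ℂ (dslope zDensity 0) (Metric.ball 0 1) :=
    (Complex.differentiableOn_dslope (Metric.ball_mem_nhds 0 one_pos)).2
      (differentiableOn_zDensity.mono ball_subset_slitOne)
  obtain ⟨G, hG0, hG⟩ := hd.isExactOn_ball.with_val_at 0 0
  have hsG (s : ℂ) (hs : s ∈ Metric.ball (0 : ℂ) 1) : s * deriv G s = zDensity s - 1 := by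
    rw [(hG s hs).deriv]
    have := sub_smul_dslope zDensity 0 s
    rwa [sub_zero, smul_eq_mul, zDensity_zero] at this
  have hpre : IsPreconnected (cutPlane ∩ Metric.ball 0 1) := by
    have h : ((1 / 2 : ℝ) : ℂ) ∈ cutPlane := ofReal_mem_cutPlane (by constructor <;> norm_num)
    push_cast at h
    have hb : (1 / 2 : ℂ) ∈ Metric.ball (0 : ℂ) 1 := by
      rw [mem_ball_zero_iff]; norm_num
    exact ((starConvex_cutPlane.inter ((convex_ball (0 : ℂ) 1).starConvex hb)).isPathConnected
      ⟨h, hb⟩).isConnected.isPreconnected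
  have hder (s : ℂ) (hs : s ∈ cutPlane ∩ Metric.ball 0 1) :
      HasDerivAt (fun s => zQuot chi phi s + Complex.I / Real.pi * (Complex.log s + G s)) 0 s := by
    convert! (hasDerivAt_zQuot hs.1).add
      (((Complex.hasDerivAt_log hs.1.1).add (hG s hs.2)).const_mul (Complex.I / Real.pi)) using 1
    have h0 := ne_zero_of_mem_cutPlane hs.1
    have h1 := hsG s hs.2
    rw [(hG s hs.2).deriv] at h1
    have h2 : -(Complex.I / Real.pi) / (s * ((1 - s) ^ (2 / 3 : ℂ) * chi s ^ 2)) =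
      -(Complex.I / Real.pi) * (s⁻¹ * zDensity s) := by
      rw [div_eq_mul_inv, mul_inv, zDensity]
    have h3 : zDensity s = s * dslope zDensity 0 s + 1 := by linear_combination -h1
    rw [h2, h3]
    field_simp
    ring
  obtain ⟨C, hC⟩ := (isOpen_cutPlane.inter Metric.isOpen_ball).exists_is_const_of_deriv_eq_zero
    hpre (fun s hs => (hder s hs).differentiableAt.differentiableWithinAt)
    (fun s hs => (hder s hs).deriv)
  refine ⟨G, C, hG0, fun s hs => ⟨(hG s hs).differentiableAt, hsG s hs⟩, fun s hs hs1 => ?_⟩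
  rw [← hC s ⟨hs, mem_ball_zero_iff.2 hs1⟩]
  ring

theorem exists_analyticAt_zQuot_eq_log : ∃ h : ℂ → ℂ, AnalyticAt ℂ h 0 ∧
    ∀ᶠ s in 𝓝[cutPlane] (0 : ℂ),
      zQuot chi phi s = Complex.I / Real.pi * (-Complex.log s + h s) + constB := by
  obtain ⟨G, C, -, hG, hz⟩ := exists_zQuot_eq_log
  have hGd : DifferentiableOn ℂ G (Metric.ball 0 1) := fun s hs =>
    (hG s hs).1.differentiableWithinAt
  refine ⟨fun s => -G s + (C - constB) * (Real.pi / Complex.I), ?_, ?_⟩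
  · exact (hGd.analyticAt (Metric.ball_mem_nhds 0 one_pos)).neg.add analyticAt_const
  · filter_upwards [self_mem_nhdsWithin,
      nhdsWithin_le_nhds (Metric.ball_mem_nhds (0 : ℂ) one_pos)] with s hs hs1
    rw [hz s hs (mem_ball_zero_iff.1 hs1)]
    have : (Real.pi : ℂ) ≠ 0 := Complex.ofReal_ne_zero.2 Real.pi_ne_zero
    have := Complex.I_ne_zero
    field_simp
    ring

/-- The factor i/π makes 2πiz contain 2 log s, so the nome is single-valued at 0 and vanishes there
to order 2. -/
theorem nome_eq_of_eq_log {s w C : ℂ} (hs : s ≠ 0) :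
    nome (-(Complex.I / Real.pi) * (Complex.log s + w) + C) =
      s ^ 2 * (nome C * Complex.exp (2 * w)) := by
  have : (Real.pi : ℂ) ≠ 0 := Complex.ofReal_ne_zero.2 Real.pi_ne_zero
  have e : 2 * Real.pi * Complex.I * (-(Complex.I / Real.pi) * (Complex.log s + w) + C) =
      (Complex.log s + Complex.log s) + (2 * Real.pi * Complex.I * C + 2 * w) := by
    field_simp
    linear_combination (-2 * (Complex.log s + w)) * Complex.I_sq
  rw [nome, e, Complex.exp_add, Complex.exp_add, Complex.exp_add, Complex.exp_log hs, nome]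
  ring

/-- The nome of the quotient, shifted by a suitable purely imaginary constant, extends to a
holomorphic function near `0` with leading term `-s² / 6912`. -/
theorem exists_nome_zQuot_eq : ∃ (δ : ℝ) (G : ℂ → ℂ), G 0 = 0 ∧
    (∀ s ∈ Metric.ball (0 : ℂ) 1, DifferentiableAt ℂ G s ∧ s * deriv G s = zDensity s - 1) ∧
    ∀ s ∈ cutPlane, ‖s‖ < 1 →
      nome (zQuot chi phi s + δ * Complex.I) = -s ^ 2 * Complex.exp (2 * G s) / 6912 := by
  obtain ⟨G, C, hG0, hG, hz⟩ := exists_zQuot_eq_log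
  -- Re z = -1/2 makes the nome a negative real on (0,1). Hence the leading coefficient `nome C`, a
  -- limit of such values divided by x², is real and nonpositive.
  have hreal {x : ℝ} (hx : x ∈ Ioo (0 : ℝ) 1) :
      nome C * Complex.exp (2 * G x) ∈ {w : ℂ | w.re ≤ 0 ∧ w.im = 0} := by
    have hxne : (x : ℂ) ≠ 0 := Complex.ofReal_ne_zero.2 hx.1.ne'
    have h1 := hz x (ofReal_mem_cutPlane hx)
      (by rw [Complex.norm_real, Real.norm_of_nonneg hx.1.le]; exact hx.2)
    have h2 := nome_eq_of_eq_log (w := G x) (C := C) hxne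
    rw [← h1] at h2
    set y := (zQuot chi phi x).im
    have h3 : nome (zQuot chi phi x) = ((-Real.exp (-(2 * Real.pi * y)) : ℝ) : ℂ) := by
      have : zQuot chi phi x = ((-1 / 2 : ℝ) : ℂ) + y * Complex.I :=
        Complex.ext (by simp [re_zQuot hx]) (by simp [y])
      rw [this, nome]
      have : 2 * Real.pi * Complex.I * (((-1 / 2 : ℝ) : ℂ) + y * Complex.I) =
          ((-(2 * Real.pi * y) : ℝ) : ℂ) + -(Real.pi * Complex.I) := by
        push_cast
        linear_combination (2 * Real.pi * y) * Complex.I_sq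
      rw [this, Complex.exp_add, Complex.exp_neg (Real.pi * Complex.I), Complex.exp_pi_mul_I,
        ← Complex.ofReal_exp]
      push_cast
      norm_num
    have h4 : nome C * Complex.exp (2 * G x) =
        ((-Real.exp (-(2 * Real.pi * y)) / x ^ 2 : ℝ) : ℂ) := by
      rw [h3] at h2
      rw [Complex.ofReal_div, h2]
      push_cast
      field_simp
    rw [h4, mem_ofPred_eq, Complex.ofReal_re, Complex.ofReal_im]
    refine ⟨?_, rfl⟩
    rw [neg_div]
    exact neg_nonpos.2 (by positivity)
  have hclosed : IsClosed {w : ℂ | w.re ≤ 0 ∧ w.im = 0} :=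
    (isClosed_le Complex.continuous_re continuous_const).inter
      (isClosed_eq Complex.continuous_im continuous_const)
  have hlim : Tendsto (fun x : ℝ => nome C * Complex.exp (2 * G x)) (𝓝[>] 0) (𝓝 (nome C)) := by
    have hGc : ContinuousAt G ((0 : ℝ) : ℂ) :=
      ((hG _ (by simp)).1).continuousAt
    have : ContinuousAt (fun x : ℝ => nome C * Complex.exp (2 * G x)) 0 :=
      continuousAt_const.mul ((continuousAt_const.mul
        (hGc.comp Complex.continuous_ofReal.continuousAt)).cexp)
    simpa [hG0] using this.tendsto.mono_left nhdsWithin_le_nhds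
  have hmem : nome C ∈ {w : ℂ | w.re ≤ 0 ∧ w.im = 0} :=
    hclosed.mem_of_tendsto hlim <| by
      filter_upwards [Ioo_mem_nhdsGT (zero_lt_one (α := ℝ))] with x hx using hreal hx
  set r : ℝ := (nome C).re
  have hCr : nome C = (r : ℂ) := Complex.ext rfl (by simp [hmem.2])
  have hr : r < 0 := lt_of_le_of_ne hmem.1 fun h => nome_ne_zero C (by rw [hCr, h]; simp)
  -- δ solves r e^{-2πδ} = -1/6912; the value 6912 = 4 · 1728 makes 1728 q start with -s²/4.
  refine ⟨Real.log (-(6912 * r)) / (2 * Real.pi), G, hG0, hG, fun s hs hs1 => ?_⟩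
  rw [hz s hs hs1, nome_add, nome_eq_of_eq_log (ne_zero_of_mem_cutPlane hs), hCr]
  have : nome (((Real.log (-(6912 * r)) / (2 * Real.pi) : ℝ) : ℂ) * Complex.I) =
      ((-(6912 * r) : ℝ) : ℂ)⁻¹ := by
    have hpi : (Real.pi : ℂ) ≠ 0 := Complex.ofReal_ne_zero.2 Real.pi_ne_zero
    have e : 2 * Real.pi * Complex.I *
        (((Real.log (-(6912 * r)) / (2 * Real.pi) : ℝ) : ℂ) * Complex.I) =
        -((Real.log (-(6912 * r)) : ℝ) : ℂ) := by
      push_cast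
      field_simp
      linear_combination ((Real.log (-(6912 * r)) : ℝ) : ℂ) * Complex.I_sq
    rw [nome, e, Complex.exp_neg, ← Complex.ofReal_exp, Real.exp_log (by linarith)]
  rw [this]
  have : (r : ℂ) ≠ 0 := Complex.ofReal_ne_zero.2 hr.ne
  push_cast
  field_simp

/-! ### The common differential system and the identities near s = 0. -/

/-- Uniqueness for the regular singular system satisfied by `(P, Q, R)` at `s = 0`: apart from the
initial value, the only resonance is at order `2`, and it is excluded by `hlead`. -/
theorem ramanujan_system_unique {X₁ X₂ X₃ Y₁ Y₂ Y₃ g : ℂ → ℂ}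
    (hX₁ : AnalyticAt ℂ X₁ 0) (hX₂ : AnalyticAt ℂ X₂ 0) (hX₃ : AnalyticAt ℂ X₃ 0)
    (hY₁ : AnalyticAt ℂ Y₁ 0) (hY₂ : AnalyticAt ℂ Y₂ 0) (hY₃ : AnalyticAt ℂ Y₃ 0)
    (hg : ContinuousAt g 0) (g0 : g 0 = 1)
    (hX₁0 : X₁ 0 = 1) (hX₂0 : X₂ 0 = 1) (hX₃0 : X₃ 0 = 1)
    (hY₁0 : Y₁ 0 = 1) (hY₂0 : Y₂ 0 = 1) (hY₃0 : Y₃ 0 = 1)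
    (hX : ∀ᶠ s in 𝓝 0, s * deriv X₁ s = g s * ((X₁ s ^ 2 - X₂ s) / 6) ∧
      s * deriv X₂ s = g s * (2 * (X₁ s * X₂ s - X₃ s) / 3) ∧
      s * deriv X₃ s = g s * (X₁ s * X₃ s - X₂ s ^ 2))
    (hY : ∀ᶠ s in 𝓝 0, s * deriv Y₁ s = g s * ((Y₁ s ^ 2 - Y₂ s) / 6) ∧
      s * deriv Y₂ s = g s * (2 * (Y₁ s * Y₂ s - Y₃ s) / 3) ∧
      s * deriv Y₃ s = g s * (Y₁ s * Y₃ s - Y₂ s ^ 2))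
    (hlead : Tendsto (fun s => ((X₂ s ^ 3 - X₃ s ^ 2) - (Y₂ s ^ 3 - Y₃ s ^ 2)) / s ^ 2)
      (𝓝[≠] 0) (𝓝 0)) :
    ∀ᶠ s in 𝓝 0, X₁ s = Y₁ s ∧ X₂ s = Y₂ s ∧ X₃ s = Y₃ s := by
  have hD : AnalyticAt ℂ (fun s => (X₁ s - Y₁ s, X₂ s - Y₂ s, X₃ s - Y₃ s)) 0 :=
    (hX₁.sub hY₁).prod ((hX₂.sub hY₂).prod (hX₃.sub hY₃))
  by_contra hne
  have hne' : ¬∀ᶠ s in 𝓝 0, (X₁ s - Y₁ s, X₂ s - Y₂ s, X₃ s - Y₃ s) = 0 := by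
    refine fun h => hne (h.mono fun s hs => ?_)
    simpa [Prod.ext_iff, sub_eq_zero] using hs
  -- If the triples differ, the difference is s^k E with E(0) ≠ 0; the system at lowest order
  -- becomes a linear condition on E(0).
  obtain ⟨k, E, hE, hE0, hDE⟩ := hD.exists_eventuallyEq_pow_smul_nonzero_iff.2 hne'
  have hE₁ : AnalyticAt ℂ (fun s => (E s).1) 0 := analyticAt_fst.comp hE
  have hE₂ : AnalyticAt ℂ (fun s => (E s).2.1) 0 := analyticAt_fst.comp (analyticAt_snd.comp hE)
  have hE₃ : AnalyticAt ℂ (fun s => (E s).2.2) 0 := analyticAt_snd.comp (analyticAt_snd.comp hE)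
  have hDE' : ∀ᶠ s in 𝓝 0, X₁ s - Y₁ s = s ^ k * (E s).1 ∧ X₂ s - Y₂ s = s ^ k * (E s).2.1 ∧
      X₃ s - Y₃ s = s ^ k * (E s).2.2 := hDE.mono fun s hs => by
    simpa [Prod.ext_iff] using hs
  have key {X Y F : ℂ → ℂ} (hX : AnalyticAt ℂ X 0) (hY : AnalyticAt ℂ Y 0) (hF : AnalyticAt ℂ F 0)
      (h : ∀ᶠ s in 𝓝 0, X s - Y s = s ^ k * F s) :
      ∀ᶠ s in 𝓝 0, s * deriv X s - s * deriv Y s = s ^ k * (k * F s + s * deriv F s) := by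
    filter_upwards [h.eventually_nhds, hX.eventually_analyticAt, hY.eventually_analyticAt,
      hF.eventually_analyticAt] with s hs hXs hYs hFs
    have e1 := (hXs.differentiableAt.hasDerivAt.sub hYs.differentiableAt.hasDerivAt).deriv
    have e2 := ((hasDerivAt_pow k s).mul hFs.differentiableAt.hasDerivAt).deriv
    have e3 : deriv (X - Y) s = deriv ((fun x => x ^ k) * F) s := by
      refine EventuallyEq.deriv_eq ?_
      filter_upwards [hs] with w hw
      exact hw
    rw [e1, e2] at e3
    rw [← mul_sub, e3]
    rcases k with _ | k
    · simp
    · rw [Nat.add_sub_cancel]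
      ring
  have k₁ := key hX₁ hY₁ hE₁ (hDE'.mono fun s h => h.1)
  have k₂ := key hX₂ hY₂ hE₂ (hDE'.mono fun s h => h.2.1)
  have k₃ := key hX₃ hY₃ hE₃ (hDE'.mono fun s h => h.2.2)
  have hlim {F H : ℂ → ℂ} (hF : AnalyticAt ℂ F 0) (hH : ContinuousAt H 0)
      (h : ∀ᶠ s in 𝓝[≠] 0, k * F s + s * deriv F s = H s) : k * F 0 = H 0 := by
    have hc : ContinuousAt (fun s => k * F s + s * deriv F s) 0 :=
      (continuousAt_const.mul hF.continuousAt).add (continuousAt_id.mul hF.deriv.continuousAt)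
    have := tendsto_nhds_unique ((hc.tendsto.mono_left nhdsWithin_le_nhds).congr' h)
      (hH.tendsto.mono_left nhdsWithin_le_nhds)
    simpa using this
  have cX₁ := hX₁.continuousAt
  have cX₂ := hX₂.continuousAt
  have cX₃ := hX₃.continuousAt
  have cY₁ := hY₁.continuousAt
  have cY₂ := hY₂.continuousAt
  have cY₃ := hY₃.continuousAt
  have cE₁ := hE₁.continuousAt
  have cE₂ := hE₂.continuousAt
  have cE₃ := hE₃.continuousAt
  have r₁ := hlim (H := fun s => g s * (((X₁ s + Y₁ s) * (E s).1 - (E s).2.1) / 6)) hE₁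
    (by fun_prop) <| by
    filter_upwards [nhdsWithin_le_nhds hX, nhdsWithin_le_nhds hY, nhdsWithin_le_nhds hDE',
      nhdsWithin_le_nhds k₁, self_mem_nhdsWithin] with s hXs hYs hD hk hs0
    apply mul_left_cancel₀ (pow_ne_zero k hs0)
    rw [← hk, hXs.1, hYs.1]
    linear_combination g s / 6 * ((X₁ s + Y₁ s) * hD.1 - hD.2.1)
  have r₂ := hlim (H := fun s => g s * (2 * (X₁ s * (E s).2.1 + Y₂ s * (E s).1 - (E s).2.2) / 3)) hE₂
    (by fun_prop) <| by
    filter_upwards [nhdsWithin_le_nhds hX, nhdsWithin_le_nhds hY, nhdsWithin_le_nhds hDE',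
      nhdsWithin_le_nhds k₂, self_mem_nhdsWithin] with s hXs hYs hD hk hs0
    apply mul_left_cancel₀ (pow_ne_zero k hs0)
    rw [← hk, hXs.2.1, hYs.2.1]
    linear_combination g s * 2 / 3 * (X₁ s * hD.2.1 + Y₂ s * hD.1 - hD.2.2)
  have r₃ := hlim (H := fun s => g s * (X₁ s * (E s).2.2 + Y₃ s * (E s).1 -
      (X₂ s + Y₂ s) * (E s).2.1)) hE₃ (by fun_prop) <| by
    filter_upwards [nhdsWithin_le_nhds hX, nhdsWithin_le_nhds hY, nhdsWithin_le_nhds hDE',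
      nhdsWithin_le_nhds k₃, self_mem_nhdsWithin] with s hXs hYs hD hk hs0
    apply mul_left_cancel₀ (pow_ne_zero k hs0)
    rw [← hk, hXs.2.2, hYs.2.2]
    linear_combination g s * (X₁ s * hD.2.2 + Y₃ s * hD.1 - (X₂ s + Y₂ s) * hD.2.1)
  simp only [g0, hX₁0, hX₂0, hY₁0, hY₂0, hY₃0, one_mul] at r₁ r₂ r₃
  set p := (E 0).1
  set u := (E 0).2.1
  set r := (E 0).2.2
  have hu : u = (2 - 6 * k) * p := by linear_combination 6 * r₁
  have hr : r = p + u - 3 / 2 * k * u := by linear_combination 3 / 2 * r₂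
  have hp : p ≠ 0 := fun hp => hE0 <| by
    have hu0 : u = 0 := by rw [hu, hp, mul_zero]
    have hr0 : r = 0 := by rw [hr, hp, hu0]; ring
    exact Prod.ext hp (Prod.ext hu0 hr0)
  -- The indicial equation, after u and r are eliminated in favour of p.
  have hk : (k : ℂ) ^ 2 * (2 - k) = 0 := by
    apply mul_left_cancel₀ hp
    rw [hr, hu] at r₃
    linear_combination -r₃ / 9
  have hk0 : k ≠ 0 := by
    rintro rfl
    have h := hDE'.self_of_nhds.1
    rw [hX₁0, hY₁0, sub_self, pow_zero, one_mul] at h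
    exact hp h.symm
  have hk2 : k = 2 := by
    rcases mul_eq_zero.1 hk with h | h
    · exact absurd (by simpa using h) hk0
    · exact_mod_cast (sub_eq_zero.1 h).symm
  -- At k = 2, (p, u, r) is proportional to (1, -10, 21), the direction of the first q-coefficients
  -- -24, 240, -504. The differential of Q³ - R² there is 3u - 2r = -72p, so `hlead` forces p = 0.
  have hc : ContinuousAt (fun s => (E s).2.1 * (X₂ s ^ 2 + X₂ s * Y₂ s + Y₂ s ^ 2) -
      (E s).2.2 * (X₃ s + Y₃ s)) 0 := by fun_prop
  have h0 := tendsto_nhds_unique ((hc.tendsto.mono_left nhdsWithin_le_nhds).congr' <| by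
    filter_upwards [nhdsWithin_le_nhds hDE', self_mem_nhdsWithin] with s hD hs0
    have hs0' : s ≠ 0 := hs0
    rw [hk2] at hD
    rw [eq_div_iff (pow_ne_zero 2 hs0')]
    linear_combination -(X₂ s ^ 2 + X₂ s * Y₂ s + Y₂ s ^ 2) * hD.2.1 + (X₃ s + Y₃ s) * hD.2.2) hlead
  simp only [hX₂0, hX₃0, hY₂0, hY₃0] at h0
  apply hp
  have h0' : u * 3 - r * 2 = 0 := by linear_combination h0
  rw [hr, hu, hk2] at h0'
  push_cast at h0'
  linear_combination -h0' / 72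

/-- The function of `s` that parametrizes Ramanujan's `P`. -/
noncomputable def paramP (s : ℂ) : ℂ :=
  (1 - s) ^ (2 / 3 : ℂ) * (chi s ^ 2 + 6 * s * chi s * deriv chi s)

/-- The function of `s` that parametrizes Ramanujan's `Q`. -/
noncomputable def paramQ (s : ℂ) : ℂ := (1 - s) ^ (1 / 3 : ℂ) * chi s ^ 4

/-- The function of `s` that parametrizes Ramanujan's `R`. -/
noncomputable def paramR (s : ℂ) : ℂ := (1 - s / 2) * chi s ^ 6

theorem cpow_two_thirds (w : ℂ) : w ^ (2 / 3 : ℂ) = (w ^ (1 / 3 : ℂ)) ^ 2 := by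
  rw [← Complex.cpow_nat_mul]
  norm_num

theorem cpow_one_third_pow_three (w : ℂ) : (w ^ (1 / 3 : ℂ)) ^ 3 = w := by
  rw [← Complex.cpow_nat_mul]
  norm_num

/-- This is (1 - s) - (1 - s/2)² = -s²/4. -/
theorem paramQ_cube_sub_paramR_sq (s : ℂ) :
    paramQ s ^ 3 - paramR s ^ 2 = -(s ^ 2 * chi s ^ 12 / 4) := by
  rw [paramQ, paramR]
  linear_combination chi s ^ 12 * cpow_one_third_pow_three (1 - s)

theorem hasDerivAt_paramP {s : ℂ} (hs : s ∈ slitOne) :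
    HasDerivAt paramP (-(2 / 3 * (1 - s) ^ (2 / 3 : ℂ) / (1 - s)) *
      (chi s ^ 2 + 6 * s * chi s * deriv chi s) + (1 - s) ^ (2 / 3 : ℂ) *
      (8 * chi s * deriv chi s + 6 * s * deriv chi s ^ 2 + 6 * s * chi s * deriv (deriv chi) s))
      s := by
  have h := (hasDerivAt_one_sub_cpow (2 / 3) hs).mul (((hasDerivAt_chi hs).pow 2).add
    ((((hasDerivAt_id' s).const_mul 6).mul (hasDerivAt_chi hs)).mul (hasDerivAt_deriv_chi hs)))
  convert! h using 1
  simp only [Pi.add_apply, Pi.mul_apply, Pi.pow_apply]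
  push_cast
  ring

theorem hasDerivAt_paramQ {s : ℂ} (hs : s ∈ slitOne) :
    HasDerivAt paramQ (-(1 / 3 * (1 - s) ^ (1 / 3 : ℂ) / (1 - s)) * chi s ^ 4 +
      (1 - s) ^ (1 / 3 : ℂ) * (4 * chi s ^ 3 * deriv chi s)) s := by
  have h := (hasDerivAt_one_sub_cpow (1 / 3) hs).mul ((hasDerivAt_chi hs).pow 4)
  convert! h using 1

theorem hasDerivAt_paramR {s : ℂ} (hs : s ∈ slitOne) :
    HasDerivAt paramR (-(1 / 2) * chi s ^ 6 + (1 - s / 2) * (6 * chi s ^ 5 * deriv chi s)) s := by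
  have h := (((hasDerivAt_id' s).div_const 2).const_sub 1).mul ((hasDerivAt_chi hs).pow 6)
  convert! h using 1

/-- The hypergeometric equation enters only in the first line, where χ₁'' occurs. The other two are
algebraic identities in (1-s)^{1/3}, χ₁ and χ₁'. -/
theorem mul_deriv_param {s : ℂ} (hs : s ∈ slitOne) :
    s * deriv paramP s = zDensity s * ((paramP s ^ 2 - paramQ s) / 6) ∧
    s * deriv paramQ s = zDensity s * (2 * (paramP s * paramQ s - paramR s) / 3) ∧
    s * deriv paramR s = zDensity s * (paramP s * paramR s - paramQ s ^ 2) := by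
  rw [(hasDerivAt_paramP hs).deriv, (hasDerivAt_paramQ hs).deriv, (hasDerivAt_paramR hs).deriv,
    zDensity, paramP, paramQ, paramR]
  have ode := chi_ode hs
  have hx := chi_ne_zero hs
  have hc := one_sub_cpow_ne_zero (1 / 3) hs
  have hc3 := cpow_one_third_pow_three (1 - s)
  rw [cpow_two_thirds]
  generalize (1 - s) ^ (1 / 3 : ℂ) = c at *
  generalize chi s = x at *
  generalize deriv (deriv chi) s = d2 at *
  generalize deriv chi s = d at *
  -- With c = (1-s)^{1/3} as the variable, all fractional powers become polynomial.
  obtain rfl : s = 1 - c ^ 3 := by rw [hc3]; ring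
  rw [sub_sub_cancel] at *
  refine ⟨?_, ?_, ?_⟩
  · field_simp
    linear_combination (108 * (1 - c ^ 3) * x) * ode
  · field_simp
    ring
  · field_simp
    ring

theorem paramP_zero : paramP 0 = 1 := by simp [paramP, chi_zero]

theorem paramQ_zero : paramQ 0 = 1 := by simp [paramQ, chi_zero]

theorem paramR_zero : paramR 0 = 1 := by simp [paramR, chi_zero]

theorem analyticOnNhd_paramP : AnalyticOnNhd ℂ paramP slitOne :=
  DifferentiableOn.analyticOnNhd
    (fun _ hs => (hasDerivAt_paramP hs).differentiableAt.differentiableWithinAt) isOpen_slitOne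

theorem analyticOnNhd_paramQ : AnalyticOnNhd ℂ paramQ slitOne :=
  DifferentiableOn.analyticOnNhd
    (fun _ hs => (hasDerivAt_paramQ hs).differentiableAt.differentiableWithinAt) isOpen_slitOne

theorem analyticOnNhd_paramR : AnalyticOnNhd ℂ paramR slitOne :=
  DifferentiableOn.analyticOnNhd
    (fun _ hs => (hasDerivAt_paramR hs).differentiableAt.differentiableWithinAt) isOpen_slitOne

/-- s q' = 2 q g with g = `zDensity`, so Ramanujan's equations pull back to the system with doubled
right-hand sides. The s²-coefficients of Q³ - R² are both -1/4, which removes the resonance. -/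
theorem eventually_ramanujan_eq_param {G : ℂ → ℂ} (hG0 : G 0 = 0)
    (hG : ∀ s ∈ Metric.ball (0 : ℂ) 1, DifferentiableAt ℂ G s ∧ s * deriv G s = zDensity s - 1) :
    ∀ᶠ s in 𝓝 0, ‖-s ^ 2 * Complex.exp (2 * G s) / 6912‖ < 1 ∧
      ramanujanP (-s ^ 2 * Complex.exp (2 * G s) / 6912) = paramP s ∧
      ramanujanQ (-s ^ 2 * Complex.exp (2 * G s) / 6912) = paramQ s ∧
      ramanujanR (-s ^ 2 * Complex.exp (2 * G s) / 6912) = paramR s := by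
  set q : ℂ → ℂ := fun s => -s ^ 2 * Complex.exp (2 * G s) / 6912 with hq
  have hq0 : q 0 = 0 := by simp [hq]
  have hqd (s : ℂ) (hs : s ∈ Metric.ball (0 : ℂ) 1) :
      DifferentiableAt ℂ q s ∧ s * deriv q s = 2 * q s * zDensity s := by
    obtain ⟨h1, h2⟩ := hG s hs
    have h := (((hasDerivAt_pow 2 s).neg).mul ((h1.hasDerivAt.const_mul 2).cexp)).div_const 6912
    have h' : HasDerivAt q _ s := h
    refine ⟨h'.differentiableAt, ?_⟩
    rw [h'.deriv, hq]
    simp only [Pi.neg_apply]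
    push_cast
    linear_combination (-2 * s ^ 2 * Complex.exp (2 * G s) / 6912) * h2
  have hball : Metric.ball (0 : ℂ) 1 ∈ 𝓝 0 := Metric.ball_mem_nhds 0 one_pos
  have hqa : AnalyticAt ℂ q 0 :=
    DifferentiableOn.analyticAt (fun s hs => (hqd s hs).1.differentiableWithinAt) hball
  have hqlt : ∀ᶠ s in 𝓝 0, ‖q s‖ < 1 := by
    refine hqa.continuousAt.norm.eventually_lt_const ?_
    simp [hq0]
  have hPa : AnalyticAt ℂ ramanujanP (q 0) := by
    rw [hq0]; exact differentiableOn_ramanujanP.analyticAt hball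
  have hQa : AnalyticAt ℂ ramanujanQ (q 0) := by
    rw [hq0]; exact differentiableOn_ramanujanQ.analyticAt hball
  have hRa : AnalyticAt ℂ ramanujanR (q 0) := by
    rw [hq0]; exact differentiableOn_ramanujanR.analyticAt hball
  have hchain {F : ℂ → ℂ} (hF : DifferentiableOn ℂ F (Metric.ball 0 1)) {s : ℂ}
      (hs : s ∈ Metric.ball (0 : ℂ) 1) (hqs : ‖q s‖ < 1) :
      s * deriv (fun s => F (q s)) s = 2 * zDensity s * (q s * deriv F (q s)) := by
    have h := (hF.differentiableAt (Metric.isOpen_ball.mem_nhds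
      (mem_ball_zero_iff.2 hqs))).hasDerivAt.comp s (hqd s hs).1.hasDerivAt
    have h' : HasDerivAt (fun s => F (q s)) _ s := h
    rw [h'.deriv]
    linear_combination deriv F (q s) * (hqd s hs).2
  have huniq := ramanujan_system_unique (X₁ := fun s => ramanujanP (q s))
    (X₂ := fun s => ramanujanQ (q s)) (X₃ := fun s => ramanujanR (q s)) (Y₁ := paramP)
    (Y₂ := paramQ) (Y₃ := paramR) (g := zDensity) (hPa.fun_comp hqa) (hQa.fun_comp hqa)
    (hRa.fun_comp hqa) (analyticOnNhd_paramP 0 zero_mem_slitOne)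
    (analyticOnNhd_paramQ 0 zero_mem_slitOne) (analyticOnNhd_paramR 0 zero_mem_slitOne)
    (differentiableOn_zDensity.differentiableAt
      (isOpen_slitOne.mem_nhds zero_mem_slitOne)).continuousAt zDensity_zero
    (by rw [hq0, ramanujanP_zero]) (by rw [hq0, ramanujanQ_zero]) (by rw [hq0, ramanujanR_zero])
    paramP_zero paramQ_zero paramR_zero ?_ ?_ ?_
  · filter_upwards [hqlt, huniq] with s h1 h2 using ⟨h1, h2⟩
  · filter_upwards [hqlt, hball] with s h1 hs
    rw [hchain differentiableOn_ramanujanP hs h1, hchain differentiableOn_ramanujanQ hs h1,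
      hchain differentiableOn_ramanujanR hs h1, mul_deriv_ramanujanP h1, mul_deriv_ramanujanQ h1,
      mul_deriv_ramanujanR h1]
    refine ⟨?_, ?_, ?_⟩ <;> ring
  · filter_upwards [isOpen_slitOne.mem_nhds zero_mem_slitOne] with s hs using mul_deriv_param hs
  · have hc : ContinuousAt (fun s => -(Complex.exp (2 * G s) * eulerProd24 (q s)) / 4 +
        chi s ^ 12 / 4) 0 := by
      have c1 : ContinuousAt G 0 := (hG 0 (by simp)).1.continuousAt
      have c2 : ContinuousAt (fun s => eulerProd24 (q s)) 0 := by
        refine ContinuousAt.comp (g := eulerProd24) ?_ hqa.continuousAt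
        rw [hq0]
        exact continuousAt_eulerProd24_zero
      have c3 := (hasDerivAt_chi zero_mem_slitOne).continuousAt
      fun_prop
    have h := hc.tendsto
    rw [hG0, hq0, eulerProd24_zero, chi_zero] at h
    norm_num at h
    refine (h.mono_left nhdsWithin_le_nhds).congr' ?_
    filter_upwards [nhdsWithin_le_nhds hqlt, self_mem_nhdsWithin] with s h1 hs0
    have hs0' : s ≠ 0 := hs0
    rw [paramQ_cube_sub_paramR_sq, ramanujanQ_cube_sub_ramanujanR_sq h1,
      eq_div_iff (pow_ne_zero 2 hs0'), hq]
    ring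

/-! ### Continuation over the cut plane. -/

theorem differentiableAt_zQuot_add (d : ℂ) {s : ℂ} (hs : s ∈ cutPlane) :
    DifferentiableAt ℂ (fun s => zQuot chi phi s + d) s :=
  (hasDerivAt_zQuot hs).differentiableAt.add_const d

theorem differentiableAt_comp_nome_zQuot {F : ℂ → ℂ} (hF : DifferentiableOn ℂ F (Metric.ball 0 1))
    {d s : ℂ} (hs : s ∈ cutPlane) (him : 0 < (zQuot chi phi s + d).im) :
    DifferentiableAt ℂ (fun s => F (nome (zQuot chi phi s + d))) s := by
  have h1 : DifferentiableAt ℂ F (nome (zQuot chi phi s + d)) :=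
    hF.differentiableAt (Metric.isOpen_ball.mem_nhds
      (mem_ball_zero_iff.2 (norm_nome_lt_one_iff.2 him)))
  exact h1.comp s ((hasDerivAt_nome _).differentiableAt.comp s (differentiableAt_zQuot_add d hs))

/-- The parametrization at the point `s`, with the quotient shifted by `d`. -/
def IsParam (d s : ℂ) : Prop :=
  ramanujanP (nome (zQuot chi phi s + d)) = paramP s ∧
  ramanujanQ (nome (zQuot chi phi s + d)) = paramQ s ∧
  ramanujanR (nome (zQuot chi phi s + d)) = paramR s

theorem exists_le_im_pow_mul_param : ∃ c > 0, ∀ d s : ℂ, 0 < (zQuot chi phi s + d).im →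
    IsParam d s → c ≤ (zQuot chi phi s + d).im ^ 6 * (‖paramQ s‖ ^ 3 + ‖paramR s‖ ^ 2) := by
  obtain ⟨c, hc, h⟩ := exists_le_im_pow_mul_ramanujan
  refine ⟨c, hc, fun d s him hp => ?_⟩
  have := h ⟨_, him⟩
  rw [← hp.2.1, ← hp.2.2]
  exact this

/-- Positivity and the identities must be continued together, since P, Q, R are controlled only for
|q| < 1. At a limit point the imaginary part y is nonnegative, and c ≤ y⁶(|Q|³ + |R|²) with finite
hypergeometric values excludes y = 0; the identity theorem on a small ball then extends the
identities. -/
theorem isParam_of_mem_cutPlane {d s₁ : ℂ} (hs₁ : s₁ ∈ cutPlane)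
    (him₁ : 0 < (zQuot chi phi s₁ + d).im) (hp₁ : ∀ᶠ t in 𝓝 s₁, IsParam d t) {s : ℂ}
    (hs : s ∈ cutPlane) : 0 < (zQuot chi phi s + d).im ∧ IsParam d s := by
  set w : ℂ → ℂ := fun s => zQuot chi phi s + d
  have hwc {s : ℂ} (hs : s ∈ cutPlane) : ContinuousAt (fun s => (w s).im) s :=
    Complex.continuous_im.continuousAt.comp (differentiableAt_zQuot_add d hs).continuousAt
  set U : Set ℂ := {s | s ∈ cutPlane ∧ 0 < (w s).im ∧ ∀ᶠ t in 𝓝 s, IsParam d t} with hU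
  have hUopen : IsOpen U := by
    rw [isOpen_iff_mem_nhds]
    rintro s ⟨hs, him, hp⟩
    filter_upwards [isOpen_cutPlane.mem_nhds hs, (hwc hs).eventually_const_lt him,
      hp.eventually_nhds] with t h1 h2 h3 using ⟨h1, h2, h3⟩
  have hsub : cutPlane ⊆ U := by
    refine isPreconnected_cutPlane.subset_of_closure_inter_subset hUopen
      ⟨s₁, hs₁, hs₁, him₁, hp₁⟩ ?_
    rintro s₀ ⟨hcl, hs₀⟩
    have : (𝓝[U] s₀).NeBot := mem_closure_iff_nhdsWithin_neBot.1 hcl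
    have him : 0 < (w s₀).im := by
      have h0 : 0 ≤ (w s₀).im := by
        refine ge_of_tendsto (x := 𝓝[U] s₀)
          ((hwc hs₀).tendsto.mono_left nhdsWithin_le_nhds) ?_
        filter_upwards [self_mem_nhdsWithin] with t ht using ht.2.1.le
      obtain ⟨c, hc, hcle⟩ := exists_le_im_pow_mul_param
      have hcont : ContinuousAt
          (fun s => (w s).im ^ 6 * (‖paramQ s‖ ^ 3 + ‖paramR s‖ ^ 2)) s₀ := by
        have c1 := hwc hs₀
        have c2 := (hasDerivAt_paramQ (mem_slitOne_of_mem_cutPlane hs₀)).continuousAt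
        have c3 := (hasDerivAt_paramR (mem_slitOne_of_mem_cutPlane hs₀)).continuousAt
        fun_prop
      have h1 : c ≤ (w s₀).im ^ 6 * (‖paramQ s₀‖ ^ 3 + ‖paramR s₀‖ ^ 2) := by
        refine ge_of_tendsto (x := 𝓝[U] s₀) (hcont.tendsto.mono_left nhdsWithin_le_nhds) ?_
        filter_upwards [self_mem_nhdsWithin] with t ht using
          hcle d t ht.2.1 ht.2.2.self_of_nhds
      refine lt_of_le_of_ne h0 fun h => ?_
      rw [← h] at h1
      simp at h1
      linarith
    obtain ⟨r, hr, hball⟩ := Metric.mem_nhds_iff.1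
      (inter_mem (isOpen_cutPlane.mem_nhds hs₀) ((hwc hs₀).eventually_const_lt him))
    obtain ⟨t₁, ht₁, ht₁r⟩ := Metric.mem_closure_iff.1 hcl r hr
    rw [dist_comm, ← Metric.mem_ball] at ht₁r
    have key {F Y : ℂ → ℂ} (hF : DifferentiableOn ℂ F (Metric.ball 0 1))
        (hY : AnalyticOnNhd ℂ Y slitOne)
        (h : ∀ᶠ t in 𝓝 t₁, F (nome (zQuot chi phi t + d)) = Y t) :
        EqOn (fun t => F (nome (zQuot chi phi t + d))) Y (Metric.ball s₀ r) := by
      refine AnalyticOnNhd.eqOn_of_preconnected_of_eventuallyEq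
        (DifferentiableOn.analyticOnNhd (fun t ht => ?_) Metric.isOpen_ball)
        (hY.mono fun t ht => mem_slitOne_of_mem_cutPlane (hball ht).1)
        (convex_ball s₀ r).isPreconnected ht₁r h
      exact (differentiableAt_comp_nome_zQuot hF (hball ht).1 (hball ht).2).differentiableWithinAt
    refine ⟨hs₀, him, ?_⟩
    have hev := ht₁.2.2
    filter_upwards [Metric.ball_mem_nhds s₀ hr] with t ht
    exact ⟨key differentiableOn_ramanujanP analyticOnNhd_paramP (hev.mono fun _ h => h.1) ht,
      key differentiableOn_ramanujanQ analyticOnNhd_paramQ (hev.mono fun _ h => h.2.1) ht,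
      key differentiableOn_ramanujanR analyticOnNhd_paramR (hev.mono fun _ h => h.2.2) ht⟩
  exact ⟨(hsub hs).2.1, (hsub hs).2.2.self_of_nhds⟩

theorem exists_isParam : ∃ δ : ℝ,
    (∀ s ∈ cutPlane, 0 < (zQuot chi phi s + δ * Complex.I).im ∧ IsParam (δ * Complex.I) s) ∧
    Tendsto (fun x : ℝ => nome (zQuot chi phi x + δ * Complex.I)) (𝓝[>] 0) (𝓝 0) := by
  obtain ⟨δ, G, hG0, hG, hz⟩ := exists_nome_zQuot_eq
  refine ⟨δ, ?_, ?_⟩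
  · have hev := (eventually_ramanujan_eq_param hG0 hG).and (Metric.ball_mem_nhds (0 : ℂ) one_pos)
    obtain ⟨r, hr, hball⟩ := Metric.eventually_nhds_iff_ball.1 hev
    set x : ℝ := min (r / 2) (1 / 2)
    have hx : x ∈ Ioo (0 : ℝ) 1 := ⟨by positivity, by
      exact (min_le_right _ _).trans_lt (by norm_num)⟩
    have hxr : (x : ℂ) ∈ Metric.ball (0 : ℂ) r := by
      rw [mem_ball_zero_iff, Complex.norm_real, Real.norm_of_nonneg hx.1.le]
      exact (min_le_left _ _).trans_lt (by linarith)
    have hxc := ofReal_mem_cutPlane hx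
    have hloc {t : ℂ} (ht : t ∈ cutPlane) (htr : t ∈ Metric.ball (0 : ℂ) r) :
        0 < (zQuot chi phi t + δ * Complex.I).im ∧ IsParam (δ * Complex.I) t := by
      obtain ⟨⟨h1, h2⟩, h3⟩ := hball t htr
      rw [← hz t ht (mem_ball_zero_iff.1 h3)] at h1 h2
      exact ⟨norm_nome_lt_one_iff.1 h1, h2⟩
    refine fun s hs => isParam_of_mem_cutPlane hxc (hloc hxc hxr).1 ?_ hs
    filter_upwards [isOpen_cutPlane.mem_nhds hxc, Metric.isOpen_ball.mem_nhds hxr] with t h1 h2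
    exact (hloc h1 h2).2
  · have hGc : ContinuousAt G ((0 : ℝ) : ℂ) := ((hG _ (by simp)).1).continuousAt
    have hc : ContinuousAt (fun x : ℝ => -(x : ℂ) ^ 2 * Complex.exp (2 * G x) / 6912) 0 := by
      have := hGc.comp (f := fun x : ℝ => (x : ℂ)) Complex.continuous_ofReal.continuousAt
      have h2 : ContinuousAt (fun x : ℝ => G x) 0 := this
      fun_prop
    have h := hc.tendsto
    norm_num at h
    refine (h.mono_left nhdsWithin_le_nhds).congr' ?_
    filter_upwards [Ioo_mem_nhdsGT (zero_lt_one (α := ℝ))] with x hx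
    rw [hz x (ofReal_mem_cutPlane hx)
      (by rw [Complex.norm_real, Real.norm_of_nonneg hx.1.le]; exact hx.2), neg_mul]

/-! ### The shift δ vanishes. -/

theorem paramQ_ne_zero {s : ℂ} (hs : s ∈ slitOne) : paramQ s ≠ 0 :=
  mul_ne_zero (one_sub_cpow_ne_zero _ hs) (pow_ne_zero 4 (chi_ne_zero hs))

theorem tendsto_chi_one : ∃ l, Tendsto (fun x : ℝ => chi x) (𝓝[<] 1) (𝓝 l) :=
  ⟨_, tendsto_eulerIntegral_one (a := 1 / 6) (b := 1 / 2) (d := 1 / 2) (by norm_num)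
    (by norm_num) (by norm_num)⟩

theorem tendsto_paramQ_one : Tendsto (fun x : ℝ => paramQ x) (𝓝[<] 1) (𝓝 0) := by
  obtain ⟨l, hl⟩ := tendsto_chi_one
  have hsub : Tendsto (fun x : ℝ => 1 - (x : ℂ)) (𝓝[<] 1) (𝓝 0) := by
    have : ContinuousAt (fun x : ℝ => 1 - (x : ℂ)) 1 := by fun_prop
    simpa using this.tendsto.mono_left nhdsWithin_le_nhds
  have hpow : Tendsto (fun w : ℂ => w ^ (1 / 3 : ℂ)) (𝓝 0) (𝓝 0) := by
    have h := (Complex.continuousAt_cpow_zero_of_re_pos (z := 1 / 3) (by norm_num)).comp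
      (x := (0 : ℂ)) (f := fun w : ℂ => (w, (1 / 3 : ℂ))) (by fun_prop)
    have := h.tendsto
    simpa [Function.comp_def] using this
  have h := (hpow.comp hsub).mul (hl.pow 4)
  rw [zero_mul] at h
  exact h

theorem tendsto_paramR_one : ∃ l, Tendsto (fun x : ℝ => paramR x) (𝓝[<] 1) (𝓝 l) := by
  obtain ⟨l, hl⟩ := tendsto_chi_one
  have : ContinuousAt (fun x : ℝ => 1 - (x : ℂ) / 2) 1 := by fun_prop
  exact ⟨_, (this.tendsto.mono_left nhdsWithin_le_nhds).mul (hl.pow 6)⟩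

theorem re_omega : (omega : ℂ).re = -1 / 2 := rfl

/-- Letting s → 1 gives Q = 0 at ω + iδ. If δ < 0, then z + iδ, descending the line Re = -1/2 from
i∞, meets ω at some s in (0,1), where Q vanishes but `paramQ` does not. If δ ≥ 0, both ω and ω + iδ
have nomes in the disc where Q is injective. -/
theorem eq_zero_of_isParam {δ : ℝ}
    (h : ∀ s ∈ cutPlane, 0 < (zQuot chi phi s + δ * Complex.I).im ∧ IsParam (δ * Complex.I) s)
    (h0 : Tendsto (fun x : ℝ => nome (zQuot chi phi x + δ * Complex.I)) (𝓝[>] 0) (𝓝 0)) :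
    δ = 0 := by
  set w : ℝ → ℂ := fun x => zQuot chi phi x + δ * Complex.I with hw
  have hw1 : Tendsto w (𝓝[<] 1) (𝓝 (omega + δ * Complex.I)) := tendsto_zQuot_one.add_const _
  have him1 := (Complex.continuous_im.tendsto _).comp hw1
  have hIoo : ∀ᶠ x : ℝ in 𝓝[<] 1, x ∈ Ioo (0 : ℝ) 1 := Ioo_mem_nhdsLT zero_lt_one
  -- The lower bound is passed to the limit s → 1, where `paramQ` and `paramR` have finite limits.
  have hpos : 0 < ((omega : ℂ) + δ * Complex.I).im := by
    have hge : 0 ≤ ((omega : ℂ) + δ * Complex.I).im := by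
      refine ge_of_tendsto him1 ?_
      filter_upwards [hIoo] with x hx using (h x (ofReal_mem_cutPlane hx)).1.le
    obtain ⟨c, hc, hcle⟩ := exists_le_im_pow_mul_param
    obtain ⟨l, hl⟩ := tendsto_paramR_one
    have hle := ge_of_tendsto ((him1.pow 6).mul
      ((tendsto_paramQ_one.norm.pow 3).add (hl.norm.pow 2))) (b := c) <| by
        filter_upwards [hIoo] with x hx
        exact hcle _ _ (h x (ofReal_mem_cutPlane hx)).1 (h x (ofReal_mem_cutPlane hx)).2
    refine lt_of_le_of_ne hge fun he => ?_
    rw [← he] at hle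
    simp at hle
    linarith
  have hQ : ramanujanQ (nome (omega + δ * Complex.I)) = 0 := by
    have hc : ContinuousAt (fun t => ramanujanQ (nome t)) ((omega : ℂ) + δ * Complex.I) :=
      ContinuousAt.comp (g := ramanujanQ) (differentiableOn_ramanujanQ.differentiableAt
        (Metric.isOpen_ball.mem_nhds (mem_ball_zero_iff.2
          (norm_nome_lt_one_iff.2 hpos)))).continuousAt (hasDerivAt_nome _).continuousAt
    refine tendsto_nhds_unique ((hc.tendsto.comp hw1).congr' ?_) tendsto_paramQ_one
    filter_upwards [hIoo] with x hx using (h x (ofReal_mem_cutPlane hx)).2.2.1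
  have hδ : 0 ≤ δ := by
    by_contra! hneg
    have ha : ∀ᶠ x in 𝓝[>] (0 : ℝ), (omega : ℂ).im < (w x).im := by
      have hpos : 0 < ‖nome omega‖ := norm_pos_iff.2 (nome_ne_zero _)
      have := h0.norm
      rw [norm_zero] at this
      filter_upwards [this.eventually_lt_const hpos] with x hx
      rw [norm_nome, norm_nome, Real.exp_lt_exp] at hx
      nlinarith [Real.pi_pos]
    have hb : ∀ᶠ x in 𝓝[<] (1 : ℝ), (w x).im < (omega : ℂ).im := by
      refine him1.eventually_lt_const ?_
      simpa using hneg
    obtain ⟨a, ha1, ha2⟩ := (ha.and (Ioo_mem_nhdsGT (zero_lt_one (α := ℝ)))).exists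
    obtain ⟨b, hb1, hb2⟩ := (hb.and (Ioo_mem_nhdsLT (zero_lt_one (α := ℝ)))).exists
    have hcont : ContinuousOn (fun x : ℝ => (w x).im) (Ioo 0 1) := fun x hx =>
      (Complex.continuous_im.continuousAt.comp
        ((differentiableAt_zQuot_add _ (ofReal_mem_cutPlane hx)).continuousAt.comp
          (f := fun x : ℝ => (x : ℂ)) Complex.continuous_ofReal.continuousAt)).continuousWithinAt
    obtain ⟨x, hx, hxe⟩ := isPreconnected_Ioo.intermediate_value hb2 ha2 hcont
      ⟨hb1.le, ha1.le⟩
    have hwx : w x = omega := Complex.ext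
      (by rw [re_omega, hw]; simp [re_zQuot hx]) hxe
    have := (h x (ofReal_mem_cutPlane hx)).2.2.1
    change ramanujanQ (nome (w x)) = _ at this
    rw [hwx, ramanujanQ_nome_omega] at this
    exact paramQ_ne_zero (mem_slitOne_of_mem_cutPlane (ofReal_mem_cutPlane hx)) this.symm
  have hle : ‖nome (omega + δ * Complex.I)‖ ≤ ‖nome omega‖ := by
    rw [norm_nome, norm_nome, Real.exp_le_exp]
    have : ((omega : ℂ) + δ * Complex.I).im = (omega : ℂ).im + δ := by simp
    rw [this]
    nlinarith [Real.pi_pos]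
  have heq := ramanujanQ_injOn (mem_closedBall_zero_iff.2 (hle.trans norm_nome_omega_le))
    (mem_closedBall_zero_iff.2 norm_nome_omega_le) (hQ.trans ramanujanQ_nome_omega.symm)
  have hn := congrArg norm heq
  rw [norm_nome, norm_nome, Real.exp_eq_exp] at hn
  have : ((omega : ℂ) + δ * Complex.I).im = (omega : ℂ).im + δ := by simp
  rw [this] at hn
  have h2 : 2 * Real.pi * δ = 0 := by linarith
  simpa [Real.pi_ne_zero] using h2

theorem zQuot_im_pos_and_isParam {s : ℂ} (hs : s ∈ cutPlane) :
    0 < (zQuot chi phi s).im ∧ IsParam 0 s := by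
  obtain ⟨δ, h, h0⟩ := exists_isParam
  obtain rfl := eq_zero_of_isParam h h0
  simpa using h s hs

/-! ### The automorphic inverse and the final statement. -/

/-- Both sides square to -s²χ₁¹²/(4 · 1728), the value of η²⁴, and the explicit root has no zero on
the connected cut plane, so the sign ε is constant. Its value is not needed. -/
theorem exists_eta_pow_zQuot_eq : ∃ ε : ℂ, ε ^ 2 = 1 ∧ ∀ s ∈ cutPlane,
    ModularForm.eta (zQuot chi phi s) ^ 12 =
      ε * (Complex.I * s * chi s ^ 6 / (2 * (√1728 : ℝ))) := by
  have hk : ((√1728 : ℝ) : ℂ) ^ 2 = 1728 := by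
    rw [← Complex.ofReal_pow, Real.sq_sqrt (by norm_num)]
    norm_num
  have hk0 : ((√1728 : ℝ) : ℂ) ≠ 0 := fun h => by rw [h] at hk; norm_num at hk
  have hf : ContinuousOn (fun s => ModularForm.eta (zQuot chi phi s) ^ 12) cutPlane := fun s hs =>
    (((analyticOnNhd_eta _ (zQuot_im_pos_and_isParam hs).1).continuousAt.comp
      (hasDerivAt_zQuot hs).continuousAt).pow 12).continuousWithinAt
  have hg : ContinuousOn (fun s => Complex.I * s * chi s ^ 6 / (2 * (√1728 : ℝ))) cutPlane := by
    have := differentiableOn_chi.continuousOn.mono fun _ hs => mem_slitOne_of_mem_cutPlane hs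
    fun_prop
  have hsq : EqOn ((fun s => ModularForm.eta (zQuot chi phi s) ^ 12) ^ 2)
      ((fun s => Complex.I * s * chi s ^ 6 / (2 * (√1728 : ℝ))) ^ 2) cutPlane := by
    intro s hs
    obtain ⟨him, h⟩ := zQuot_im_pos_and_isParam hs
    have h1 := ramanujanQ_cube_sub_ramanujanR_sq_nome ⟨_, him⟩
    rw [IsParam, add_zero] at h
    simp only at h1
    rw [h.2.1, h.2.2, paramQ_cube_sub_paramR_sq] at h1
    simp only [Pi.pow_apply]
    rw [div_pow, eq_div_iff (pow_ne_zero 2 (mul_ne_zero two_ne_zero hk0)), mul_pow, hk]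
    linear_combination -4 * h1 - s ^ 2 * chi s ^ 12 * Complex.I_sq
  rcases isPreconnected_cutPlane.eq_or_eq_neg_of_sq_eq hf hg hsq (fun {s} hs =>
    div_ne_zero (mul_ne_zero (mul_ne_zero Complex.I_ne_zero (ne_zero_of_mem_cutPlane hs))
      (pow_ne_zero 6 (chi_ne_zero (mem_slitOne_of_mem_cutPlane hs))))
      (mul_ne_zero two_ne_zero hk0)) with h | h
  · exact ⟨1, one_pow 2, fun s hs => by rw [one_mul]; exact h hs⟩
  · exact ⟨-1, by norm_num, fun s hs => by rw [neg_one_mul]; exact h hs⟩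

theorem exists_automorphic_inverse : ∃ S : ℂ → ℂ, MeromorphicOn S {z : ℂ | 0 < z.im} ∧
    (∀ γ ∈ GammaSq, ∀ τ : UpperHalfPlane, S ((γ • τ : UpperHalfPlane) : ℂ) = S (τ : ℂ)) ∧
    ∀ s ∈ cutPlane, S (zQuot chi phi s) = s := by
  obtain ⟨ε, hε, heta⟩ := exists_eta_pow_zQuot_eq
  have hk0 : ((√1728 : ℝ) : ℂ) ≠ 0 := Complex.ofReal_ne_zero.2 (by positivity)
  -- The constant scales R/η¹² at z(s) to 2/s - 1, and the witness solves this for s.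
  refine ⟨fun τ => 2 / (1 + ε * Complex.I / (√1728 : ℝ) * ramanujanRDivEta τ), ?_, ?_, ?_⟩
  · exact analyticOnNhd_const.meromorphicOn.div (analyticOnNhd_const.add
      (analyticOnNhd_const.mul analyticOnNhd_ramanujanRDivEta)).meromorphicOn
  · intro γ hγ τ
    simp only [ramanujanRDivEta_smul_of_mem hγ]
  · intro s hs
    have hs0 := ne_zero_of_mem_cutPlane hs
    have hx := chi_ne_zero (mem_slitOne_of_mem_cutPlane hs)
    have hI := Complex.I_ne_zero
    have hε0 : ε ≠ 0 := fun h => by simp [h] at hε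
    obtain ⟨-, h⟩ := zQuot_im_pos_and_isParam hs
    rw [IsParam, add_zero] at h
    have hd : 1 + ε * Complex.I / (√1728 : ℝ) * ramanujanRDivEta (zQuot chi phi s) = 2 / s := by
      rw [ramanujanRDivEta, heta s hs, h.2.2, paramR]
      field_simp
      ring
    simp only [hd]
    field_simp

end

theorem mainTheorem4 :
    GammaSq.Normal ∧ GammaSq.index = 2 ∧
    ∃ χ₁ φ : ℂ → ℂ,
      -- the principal branches of `₂F₁(1/6, 1/2; 1; ·)` and `₂F₁(1/6, 1/2; 2/3; ·)`
      IsHypergeometricBranch (1 / 6) (1 / 2) 1 χ₁ ∧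
      IsHypergeometricBranch (1 / 6) (1 / 2) (2 / 3) φ ∧
      -- normalization of the quotient at `s = 0` and `s = 1`
      (∃ h : ℂ → ℂ, AnalyticAt ℂ h 0 ∧
        ∀ᶠ s in 𝓝[cutPlane] (0 : ℂ),
          zQuot χ₁ φ s = Complex.I / Real.pi * (-Complex.log s + h s) + constB) ∧
      Tendsto (fun x : ℝ => zQuot χ₁ φ (x : ℂ)) (𝓝[<] 1)
        (𝓝 (Complex.exp (2 * Real.pi * Complex.I / 3))) ∧
      -- the quotient is inverted by a meromorphic function that is automorphic under `Γ²`
      (∃ S : ℂ → ℂ, MeromorphicOn S {z : ℂ | 0 < z.im} ∧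
        (∀ γ ∈ GammaSq, ∀ τ : UpperHalfPlane,
          S ((γ • τ : UpperHalfPlane) : ℂ) = S (τ : ℂ)) ∧
        ∀ s ∈ cutPlane, S (zQuot χ₁ φ s) = s) ∧
      -- the parametrization, with `q = e^{2πi z(s)}`
      ∀ s ∈ cutPlane,
        χ₁ s ≠ 0 ∧
        0 < (zQuot χ₁ φ s).im ∧
        ramanujanP (Complex.exp (2 * Real.pi * Complex.I * zQuot χ₁ φ s)) =
          (1 - s) ^ (2 / 3 : ℂ) * (χ₁ s ^ 2 + 6 * s * χ₁ s * deriv χ₁ s) ∧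
        ramanujanQ (Complex.exp (2 * Real.pi * Complex.I * zQuot χ₁ φ s)) =
          (1 - s) ^ (1 / 3 : ℂ) * χ₁ s ^ 4 ∧
        ramanujanR (Complex.exp (2 * Real.pi * Complex.I * zQuot χ₁ φ s)) =
          (1 - s / 2) * χ₁ s ^ 6 := by
  refine ⟨GammaSq_normal, GammaSq_index, chi, phi, isHypergeometricBranch_chi,
    isHypergeometricBranch_phi, exists_analyticAt_zQuot_eq_log, ?_, exists_automorphic_inverse,
    fun s hs => ?_⟩
  · rw [← omega_eq_exp]
    exact tendsto_zQuot_one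
  · obtain ⟨him, hP, hQ, hR⟩ := zQuot_im_pos_and_isParam hs
    rw [add_zero] at hP hQ hR
    exact ⟨chi_ne_zero (mem_slitOne_of_mem_cutPlane hs), him, hP, hQ, hR⟩
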